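/- Let $N\ge 1$, $1<p<\infty$, $0<s<1$, and let $\Omega\subset\mathbb R^N$ be any open set. For measurable $u:\mathbb R^N\to\mathbb R$ put $$[u]_{s,p}^p=\iint_{\mathbb R^{2N}}\frac{|u(x)-u(y)|^p}{|x-y|^{N+sp}}\,dx\,dy .$$ For a bounded open set $U\subset\mathbb R^N$ let $\mathcal D_0^{s,p}(U)$ be the completion of $C_c^\infty(U)$ with respect to $[\,\cdot\,]_{s,p}$ (equivalently, since $U$ is bounded, with respect to $\|u\|_{L^p}+[u]_{s,p}$, so that it is a space of functions on $\mathbb R^N$ vanishing a.e. outside $U$), and let $w_{s,p,U}$ be the unique minimiser over $u\in\mathcal D_0^{s,p}(U)$ of $$\frac1p[u]_{s,p}^p-\int_U u\,dx .$$ For the open set $\Omega$ let $w_{s,p,\Omega}:\Omega\to[0,\infty]$ be the a.e. limit of the a.e. nondecreasing sequence $w_{s,p,\Omega\cap B_n(0)}$, $n\to\infty$, where each of these functions is extended by $0$ outside $\Omega\cap B_n(0)$. Then $$\int_\Omega\frac{|u|^p}{w_{s,p,\Omega}^{p-1}}\,dx\le\iint_{\mathbb R^{2N}}\frac{|u(x)-u(y)|^p}{|x-y|^{N+sp}}\,dx\,dy\qquad\text{for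 all }u\in C_c^\infty(\Omega),$$ with the convention $c/\infty=0$. -/

import Mathlib

open MeasureTheory Filter Topology
open scoped ENNReal ContDiff

noncomputable section

/-- `u ∈ C_c^∞(Ω)`: a smooth real function whose (compact) support is contained in `Ω`. -/
structure IsTestFunction {N : ℕ} (Ω : Set (EuclideanSpace ℝ (Fin N)))
    (u : EuclideanSpace ℝ (Fin N) → ℝ) : Prop where
  contDiff : ContDiff ℝ ∞ u
  hasCompactSupport : HasCompactSupport u
  tsupport_subset : tsupport u ⊆ Ω

/-- The `p`-th power `[u]_{s,p}^p` of the Gagliardo norm over `ℝ^N × ℝ^N`, with values in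
`[0,∞]`. (On the diagonal the integrand is `0`.) -/
def gagliardo {N : ℕ} (s p : ℝ) (u : EuclideanSpace ℝ (Fin N) → ℝ) : ℝ≥0∞ :=
  ∫⁻ x, ∫⁻ y, ENNReal.ofReal (|u x - u y| ^ p / ‖x - y‖ ^ ((N : ℝ) + s * p))

/-- `u ∈ D_0^{s,p}(Ω)`, for `Ω` open and bounded: the completion of `C_c^∞(Ω)`, realised as the
space of (a.e. classes of) functions on `ℝ^N` that are limits of sequences in `C_c^∞(Ω)` with
respect to the norm `‖u‖_{L^p} + [u]_{s,p}`. On bounded open sets this norm is equivalent to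
`[u]_{s,p}` on `C_c^∞(Ω)`, so that both norms have the same completion. -/
def MemD0 {N : ℕ} (s p : ℝ) (Ω : Set (EuclideanSpace ℝ (Fin N)))
    (u : EuclideanSpace ℝ (Fin N) → ℝ) : Prop :=
  AEStronglyMeasurable u volume ∧
    ∃ φ : ℕ → EuclideanSpace ℝ (Fin N) → ℝ,
      (∀ n, IsTestFunction Ω (φ n)) ∧
      Tendsto (fun n => eLpNorm (φ n - u) (ENNReal.ofReal p) volume) atTop (𝓝 0) ∧
      Tendsto (fun n => gagliardo s p (φ n - u)) atTop (𝓝 0)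

/-- The energy `(1/p) [u]_{s,p}^p - ∫_Ω u`; both terms are finite for `u ∈ D_0^{s,p}(Ω)`,
`Ω` bounded. -/
def torsionEnergy {N : ℕ} (s p : ℝ) (Ω : Set (EuclideanSpace ℝ (Fin N)))
    (u : EuclideanSpace ℝ (Fin N) → ℝ) : ℝ :=
  (1 / p) * (gagliardo s p u).toReal - ∫ x in Ω, u x

/-- `w` is (a representative of) the minimiser over `D_0^{s,p}(Ω)` of the torsion energy, for
`Ω` open and bounded. -/
def IsTorsionMinimizer {N : ℕ} (s p : ℝ) (Ω : Set (EuclideanSpace ℝ (Fin N)))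
    (w : EuclideanSpace ℝ (Fin N) → ℝ) : Prop :=
  MemD0 s p Ω w ∧ ∀ v, MemD0 s p Ω v → torsionEnergy s p Ω w ≤ torsionEnergy s p Ω v

open Classical in
/-- The `(s,p)`-torsion function of a bounded open set `Ω`: the a.e. unique minimiser of the
torsion energy, set equal to `0` outside `Ω`. (If there were no minimiser, it would be `0`.) -/
def torsionBounded {N : ℕ} (s p : ℝ) (Ω : Set (EuclideanSpace ℝ (Fin N))) :
    EuclideanSpace ℝ (Fin N) → ℝ :=
  if h : ∃ w, IsTorsionMinimizer s p Ω w then Ω.indicator h.choose else 0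

/-- The `(s,p)`-torsion function of an arbitrary open set `Ω`, with values in `[0,∞]`: the limit
as `n → ∞` of the torsion functions of `Ω ∩ B_n(0)`. The sequence is a.e. nonnegative and
a.e. nondecreasing in `n`, so that the `limsup` is a limit at almost every point. The radii are
integers because the torsion functions of bounded sets are only defined almost everywhere: a
countable family leaves one null set, and by monotonicity gives the same limit as all radii. -/
def torsionFunction {N : ℕ} (s p : ℝ) (Ω : Set (EuclideanSpace ℝ (Fin N)))
    (x : EuclideanSpace ℝ (Fin N)) : ℝ≥0∞ :=
  limsup (fun n : ℕ =>
    ENNReal.ofReal (torsionBounded s p (Ω ∩ Metric.ball 0 (n : ℝ)) x)) atTop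

end

/-!
The inequality is first proved on a bounded set `U`, for the minimiser `w` of the torsion energy
`J(v) = (1/p) [v]^p - ∫_U v`, by testing minimality with the power means
`w_t = ((1 - t) w^p + t |u|^p)^(1/p)`. By Minkowski's inequality for a weighted `ℓ^p` norm on the
plane, `[·]^p` is convex along this curve: `[w_t]^p ≤ (1 - t) [w]^p + t [u]^p`. Hence
`J(w) ≤ J(w_t)` gives `∫_U (w_t - w) ≤ (t / p) ([u]^p - [w]^p)`. After division by `t / p`, Fatou's
lemma as `t → 0` yields `∫_U |u|^p / w^(p-1) - ∫_U w ≤ [u]^p - [w]^p`, and `∫_U w = [w]^p` because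
`c ↦ J(c w)` is minimal at `c = 1` (`IsTorsionMinimizer.lintegral_div_rpow_le`). Where `w = 0` and
`u ≠ 0` the difference quotients tend to `∞`, so that no strong minimum principle is needed: the
inequality itself shows that `w > 0` almost everywhere on `{u ≠ 0}`.

The power means of `w` are not known to belong to `D_0^{s,p}(U)`. Instead `w` is replaced by
approximating test functions and the absolute values by `√(· ^ 2 + η ^ 2)`; the resulting competitors
(`smoothPowerMean`) are test functions, and Fatou's lemma recovers the estimate for `w_t`
(`IsTorsionMinimizer.lintegral_powerMean_le`).

A minimiser has to be shown to exist, as the torsion function would otherwise be `0`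
(`exists_isTorsionMinimizer`). The energy is coercive by a Poincaré inequality, and a minimising
sequence of test functions is Cauchy by a quantitative strict convexity of `|·|^p`
(`exists_abs_sub_rpow_le`), which holds for every `p > 1` by compactness and homogeneity.

For a general open set, `u` is a test function for `Ω ∩ B_n(0)` once `n` is large, and
`c / (limsup a_n)^(p-1) = liminf c / a_n^(p-1)`, so the claim follows from Fatou's lemma in `n`. This
does not use that the torsion functions are monotone in `n`. The estimate holds for every extended
value of the limit: where the torsion function is infinite, the integrand on the left is `0`.
-/

/-! ### Difference quotients and the Gagliardo seminorm -/

/-- The fractional difference quotient `(u x - u y) / |x - y| ^ ((N + s p) / p)`, a linear function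
of `u` whose `L^p` norm over `ℝ^N × ℝ^N` is the Gagliardo seminorm (`gagliardo_eq_eLpNorm`). -/
noncomputable def fracQuotient {N : ℕ} (s p : ℝ) (u : EuclideanSpace ℝ (Fin N) → ℝ)
    (z : EuclideanSpace ℝ (Fin N) × EuclideanSpace ℝ (Fin N)) : ℝ :=
  (u z.1 - u z.2) / ‖z.1 - z.2‖ ^ (((N : ℝ) + s * p) / p)

theorem fracQuotient_sub {N : ℕ} (s p : ℝ) (u v : EuclideanSpace ℝ (Fin N) → ℝ) :
    fracQuotient s p (u - v) = fracQuotient s p u - fracQuotient s p v := by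
  ext z
  simp only [fracQuotient, Pi.sub_apply]
  ring

theorem abs_fracQuotient_rpow {N : ℕ} {s p : ℝ} (hp : 0 < p)
    (u : EuclideanSpace ℝ (Fin N) → ℝ)
    (z : EuclideanSpace ℝ (Fin N) × EuclideanSpace ℝ (Fin N)) :
    |fracQuotient s p u z| ^ p =
      |u z.1 - u z.2| ^ p / ‖z.1 - z.2‖ ^ ((N : ℝ) + s * p) := by
  rw [fracQuotient, abs_div, Real.div_rpow (abs_nonneg _) (abs_nonneg _),
    abs_of_nonneg (Real.rpow_nonneg (norm_nonneg _) _), ← Real.rpow_mul (norm_nonneg _),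
    div_mul_cancel₀ _ hp.ne']

theorem aestronglyMeasurable_fracQuotient {N : ℕ} {s p : ℝ}
    {u : EuclideanSpace ℝ (Fin N) → ℝ} (hu : AEStronglyMeasurable u volume) :
    AEStronglyMeasurable (fracQuotient s p u) volume := by
  have h1 : AEStronglyMeasurable (fun z : EuclideanSpace ℝ (Fin N) × EuclideanSpace ℝ (Fin N) =>
      u z.1) volume := by
    rw [Measure.volume_eq_prod]; exact hu.comp_fst
  have h2 : AEStronglyMeasurable (fun z : EuclideanSpace ℝ (Fin N) × EuclideanSpace ℝ (Fin N) =>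
      u z.2) volume := by
    rw [Measure.volume_eq_prod]; exact hu.comp_snd
  have h3 : Measurable (fun z : EuclideanSpace ℝ (Fin N) × EuclideanSpace ℝ (Fin N) =>
      ‖z.1 - z.2‖ ^ (((N : ℝ) + s * p) / p)) := by fun_prop
  exact ((h1.sub h2).aemeasurable.div h3.aemeasurable).aestronglyMeasurable

theorem gagliardo_eq_lintegral {N : ℕ} {s p : ℝ} (hp : 0 < p)
    {u : EuclideanSpace ℝ (Fin N) → ℝ} (hu : AEStronglyMeasurable u volume) :
    gagliardo s p u = ∫⁻ z, ENNReal.ofReal (|fracQuotient s p u z| ^ p) := by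
  have hm : AEMeasurable (fun z : EuclideanSpace ℝ (Fin N) × EuclideanSpace ℝ (Fin N) =>
      ENNReal.ofReal (|fracQuotient s p u z| ^ p)) (volume.prod volume) := by
    have h := (aestronglyMeasurable_fracQuotient (s := s) (p := p) hu).aemeasurable
    rw [Measure.volume_eq_prod] at h
    have h2 : AEMeasurable (fun z => |fracQuotient s p u z|) (volume.prod volume) :=
      continuous_abs.measurable.comp_aemeasurable h
    exact (h2.pow_const p).ennreal_ofReal
  rw [Measure.volume_eq_prod, lintegral_prod _ hm]
  simp only [gagliardo, abs_fracQuotient_rpow hp]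

theorem lintegral_ofReal_abs_rpow {α : Type*} [MeasurableSpace α] {μ : Measure α} {p : ℝ}
    (hp : 0 < p) (f : α → ℝ) :
    ∫⁻ z, ENNReal.ofReal (|f z| ^ p) ∂μ = eLpNorm f (ENNReal.ofReal p) μ ^ p := by
  rw [eLpNorm_eq_lintegral_rpow_enorm_toReal (by simpa using hp) ENNReal.ofReal_ne_top,
    ENNReal.toReal_ofReal hp.le, ← ENNReal.rpow_mul, one_div, inv_mul_cancel₀ hp.ne',
    ENNReal.rpow_one]
  refine lintegral_congr fun z => ?_
  rw [Real.enorm_eq_ofReal_abs, ENNReal.ofReal_rpow_of_nonneg (abs_nonneg _) hp.le]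

theorem gagliardo_eq_eLpNorm {N : ℕ} {s p : ℝ} (hp : 0 < p)
    {u : EuclideanSpace ℝ (Fin N) → ℝ} (hu : AEStronglyMeasurable u volume) :
    gagliardo s p u = eLpNorm (fracQuotient s p u) (ENNReal.ofReal p) volume ^ p := by
  rw [gagliardo_eq_lintegral hp hu, lintegral_ofReal_abs_rpow hp]

theorem gagliardo_smul {N : ℕ} {s p : ℝ} (c : ℝ)
    (u : EuclideanSpace ℝ (Fin N) → ℝ) :
    gagliardo s p (c • u) = ENNReal.ofReal (|c| ^ p) * gagliardo s p u := by
  simp only [gagliardo]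
  have key : ∀ x y : EuclideanSpace ℝ (Fin N),
      ENNReal.ofReal (|(c • u) x - (c • u) y| ^ p / ‖x - y‖ ^ ((N : ℝ) + s * p)) =
      ENNReal.ofReal (|c| ^ p) *
        ENNReal.ofReal (|u x - u y| ^ p / ‖x - y‖ ^ ((N : ℝ) + s * p)) := by
    intro x y
    rw [← ENNReal.ofReal_mul (by positivity)]
    congr 1
    rw [Pi.smul_apply, Pi.smul_apply, smul_eq_mul, smul_eq_mul, ← mul_sub, abs_mul,
      Real.mul_rpow (abs_nonneg _) (abs_nonneg _)]
    ring
  simp only [key, lintegral_const_mul' _ _ ENNReal.ofReal_ne_top]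

/-! ### Test functions -/

namespace IsTestFunction

variable {N : ℕ} {U : Set (EuclideanSpace ℝ (Fin N))} {u v : EuclideanSpace ℝ (Fin N) → ℝ}

theorem zero (U : Set (EuclideanSpace ℝ (Fin N))) : IsTestFunction U 0 where
  contDiff := contDiff_const
  hasCompactSupport := HasCompactSupport.zero
  tsupport_subset := by simp

/-- A smooth function that vanishes where two test functions vanish is a test function. -/
theorem of_eq_zero (hu : IsTestFunction U u) (hv : IsTestFunction U v)
    {w : EuclideanSpace ℝ (Fin N) → ℝ} (hw : ContDiff ℝ ∞ w)
    (h : ∀ x, u x = 0 → v x = 0 → w x = 0) : IsTestFunction U w := by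
  have hsub : tsupport w ⊆ tsupport u ∪ tsupport v := by
    refine closure_minimal (fun x hx => ?_)
      ((isClosed_tsupport u).union (isClosed_tsupport v))
    by_contra hcon
    simp only [Set.mem_union, not_or] at hcon
    exact hx (h x (image_eq_zero_of_notMem_tsupport hcon.1)
      (image_eq_zero_of_notMem_tsupport hcon.2))
  refine ⟨hw, ?_, hsub.trans (Set.union_subset hu.tsupport_subset hv.tsupport_subset)⟩
  exact (hu.hasCompactSupport.isCompact.union hv.hasCompactSupport.isCompact).of_isClosed_subset
    (isClosed_tsupport w) hsub

theorem add (hu : IsTestFunction U u) (hv : IsTestFunction U v) : IsTestFunction U (u + v) :=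
  of_eq_zero hu hv (hu.contDiff.add hv.contDiff) fun x h1 h2 => by simp [h1, h2]

theorem sub (hu : IsTestFunction U u) (hv : IsTestFunction U v) : IsTestFunction U (u - v) :=
  of_eq_zero hu hv (hu.contDiff.sub hv.contDiff) fun x h1 h2 => by simp [h1, h2]

theorem smul (c : ℝ) (hu : IsTestFunction U u) : IsTestFunction U (c • u) :=
  of_eq_zero hu hu (hu.contDiff.const_smul c) fun x h1 _ => by simp [h1]

theorem eq_zero (hu : IsTestFunction U u) {x : EuclideanSpace ℝ (Fin N)} (hx : x ∉ U) :
    u x = 0 :=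
  image_eq_zero_of_notMem_tsupport fun h => hx (hu.tsupport_subset h)

theorem continuous (hu : IsTestFunction U u) : Continuous u := hu.contDiff.continuous

theorem aestronglyMeasurable (hu : IsTestFunction U u) : AEStronglyMeasurable u volume :=
  hu.continuous.aestronglyMeasurable

theorem memLp (hu : IsTestFunction U u) (q : ℝ≥0∞) : MemLp u q volume :=
  hu.continuous.memLp_of_hasCompactSupport hu.hasCompactSupport

end IsTestFunction

/-- The radial kernel that dominates the Gagliardo integrand of a bounded Lipschitz function is
integrable: near the origin because `s < 1`, at infinity because `0 < s`. -/
theorem integrable_min_rpow_div_norm_rpow {N : ℕ} (hN : 1 ≤ N) {s p : ℝ} (hs0 : 0 < s)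
    (hs1 : s < 1) (hp : 0 < p) :
    Integrable (fun z : EuclideanSpace ℝ (Fin N) =>
      min (‖z‖ ^ p) 1 / ‖z‖ ^ ((N : ℝ) + s * p)) volume := by
  have : Nonempty (Fin N) := ⟨⟨0, hN⟩⟩
  rw [integrable_fun_norm_addHaar (E := EuclideanSpace ℝ (Fin N)) volume
    (f := fun r : ℝ => min (r ^ p) 1 / r ^ ((N : ℝ) + s * p))]
  have hsp : 0 < s * p := mul_pos hs0 hp
  have hsp' : s * p < p := by nlinarith
  rw [finrank_euclideanSpace_fin]
  have hmeas : Measurable (fun y : ℝ => y ^ (N - 1) • (min (y ^ p) 1 / y ^ ((N : ℝ) + s * p))) := by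
    fun_prop
  have hpow : ∀ y : ℝ, 0 < y → y ^ (N - 1) = y ^ ((N : ℝ) - 1) := by
    intro y hy
    rw [← Real.rpow_natCast, Nat.cast_sub hN, Nat.cast_one]
  rw [← Set.Ioo_union_Ici_eq_Ioi (zero_lt_one' ℝ), integrableOn_union]
  constructor
  · have hi : IntegrableOn (fun y : ℝ => y ^ (p - s * p - 1)) (Set.Ioo 0 1) :=
      (intervalIntegral.integrableOn_Ioo_rpow_iff zero_lt_one).2 (by linarith)
    refine Integrable.mono' hi hmeas.aestronglyMeasurable ?_
    filter_upwards [ae_restrict_mem measurableSet_Ioo] with y hy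
    have hy0 := hy.1
    rw [smul_eq_mul, Real.norm_of_nonneg (by positivity), hpow y hy0]
    calc _ ≤ y ^ ((N : ℝ) - 1) * (y ^ p / y ^ ((N : ℝ) + s * p)) := by
            gcongr; exact min_le_left _ _
      _ = _ := by
        rw [← Real.rpow_sub hy0, ← Real.rpow_add hy0]; congr 1; ring
  · rw [integrableOn_Ici_iff_integrableOn_Ioi]
    have hi : IntegrableOn (fun y : ℝ => y ^ (-1 - s * p)) (Set.Ioi 1) :=
      integrableOn_Ioi_rpow_of_lt (by linarith) zero_lt_one
    refine Integrable.mono' hi hmeas.aestronglyMeasurable ?_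
    filter_upwards [ae_restrict_mem measurableSet_Ioi] with y hy
    have hy0 : 0 < y := zero_lt_one.trans hy
    rw [smul_eq_mul, Real.norm_of_nonneg (by positivity), hpow y hy0]
    calc _ ≤ y ^ ((N : ℝ) - 1) * (y ^ (0 : ℝ) / y ^ ((N : ℝ) + s * p)) := by
            rw [Real.rpow_zero]; gcongr; exact min_le_right _ _
      _ = _ := by
        rw [← Real.rpow_sub hy0, ← Real.rpow_add hy0]; congr 1; ring

/-- The integrand vanishes unless one of the two points lies in the support of `u`, which has finite
measure, and it is dominated by the kernel of `integrable_min_rpow_div_norm_rpow`. -/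
theorem IsTestFunction.gagliardo_ne_top {N : ℕ} (hN : 1 ≤ N) {s p : ℝ} (hs0 : 0 < s)
    (hs1 : s < 1) (hp : 0 < p) {U : Set (EuclideanSpace ℝ (Fin N))}
    {u : EuclideanSpace ℝ (Fin N) → ℝ} (hu : IsTestFunction U u) :
    gagliardo s p u ≠ ⊤ := by
  obtain ⟨L, hL⟩ := ContDiff.lipschitzWith_of_hasCompactSupport hu.hasCompactSupport
    hu.contDiff (by simp)
  obtain ⟨M, hM⟩ := hu.hasCompactSupport.exists_bound_of_continuous hu.continuous
  have hM0 : 0 ≤ M := (norm_nonneg _).trans (hM 0)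
  set K := tsupport u with hK
  have hKm : MeasurableSet K := (isClosed_tsupport u).measurableSet
  set C : ℝ := max ((L : ℝ) ^ p) ((2 * M) ^ p) with hC
  have hC0 : 0 ≤ C := le_max_of_le_left (by positivity)
  set k : EuclideanSpace ℝ (Fin N) → ℝ≥0∞ := fun z =>
    ENNReal.ofReal (C * (min (‖z‖ ^ p) 1 / ‖z‖ ^ ((N : ℝ) + s * p))) with hk
  have hkm : Measurable k := by rw [hk]; fun_prop
  have hkI : ∫⁻ z, k z ≠ ⊤ :=
    ((integrable_min_rpow_div_norm_rpow hN hs0 hs1 hp).const_mul C).lintegral_lt_top.ne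
  have hbound : ∀ x y : EuclideanSpace ℝ (Fin N),
      ENNReal.ofReal (|u x - u y| ^ p / ‖x - y‖ ^ ((N : ℝ) + s * p)) ≤
        K.indicator (fun _ => k (x - y)) x + K.indicator (fun _ => k (x - y)) y := by
    intro x y
    by_cases hxy : x ∉ K ∧ y ∉ K
    · rw [image_eq_zero_of_notMem_tsupport hxy.1, image_eq_zero_of_notMem_tsupport hxy.2]
      simp [Real.zero_rpow hp.ne']
    · have hle : ENNReal.ofReal (|u x - u y| ^ p / ‖x - y‖ ^ ((N : ℝ) + s * p)) ≤ k (x - y) := by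
        refine ENNReal.ofReal_le_ofReal ?_
        rw [← mul_div_assoc]
        gcongr
        rw [mul_min_of_nonneg _ _ hC0]
        refine le_min ?_ ?_
        · have h1 : |u x - u y| ≤ L * ‖x - y‖ := by
            simpa [Real.dist_eq, dist_eq_norm] using hL.dist_le_mul x y
          calc |u x - u y| ^ p ≤ (L * ‖x - y‖) ^ p := by gcongr
            _ = (L : ℝ) ^ p * ‖x - y‖ ^ p := Real.mul_rpow L.coe_nonneg (norm_nonneg _)
            _ ≤ _ := by gcongr; exact le_max_left _ _
        · have h1 : |u x - u y| ≤ 2 * M := by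
            have := abs_sub (u x) (u y)
            have h2 := hM x
            have h3 := hM y
            rw [Real.norm_eq_abs] at h2 h3
            linarith
          calc |u x - u y| ^ p ≤ (2 * M) ^ p := by gcongr
            _ ≤ C * 1 := by rw [mul_one]; exact le_max_right _ _
      by_cases hx : x ∈ K
      · rw [Set.indicator_of_mem hx]; exact hle.trans le_self_add
      · have hy : y ∈ K := by tauto
        rw [Set.indicator_of_mem hy]; exact hle.trans le_add_self
  have hm1 : Measurable (fun z : EuclideanSpace ℝ (Fin N) × EuclideanSpace ℝ (Fin N) =>
      K.indicator (fun _ => k (z.1 - z.2)) z.1) := by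
    have : (fun z : EuclideanSpace ℝ (Fin N) × EuclideanSpace ℝ (Fin N) =>
      K.indicator (fun _ => k (z.1 - z.2)) z.1) =
      (Prod.fst ⁻¹' K).indicator (fun z => k (z.1 - z.2)) := by
      rfl
    rw [this]
    exact (hkm.comp (by fun_prop)).indicator (measurable_fst hKm)
  have hm2 : Measurable (fun z : EuclideanSpace ℝ (Fin N) × EuclideanSpace ℝ (Fin N) =>
      K.indicator (fun _ => k (z.1 - z.2)) z.2) := by
    have : (fun z : EuclideanSpace ℝ (Fin N) × EuclideanSpace ℝ (Fin N) =>
      K.indicator (fun _ => k (z.1 - z.2)) z.2) =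
      (Prod.snd ⁻¹' K).indicator (fun z => k (z.1 - z.2)) := by
      rfl
    rw [this]
    exact (hkm.comp (by fun_prop)).indicator (measurable_snd hKm)
  have hKfin : volume K ≠ ⊤ := hu.hasCompactSupport.isCompact.measure_lt_top.ne
  have hI1 : ∫⁻ x, ∫⁻ y, K.indicator (fun _ => k (x - y)) x = (∫⁻ z, k z) * volume K := by
    have : ∀ x, ∫⁻ y, K.indicator (fun _ => k (x - y)) x =
        K.indicator (fun _ => ∫⁻ z, k z) x := by
      intro x
      by_cases hx : x ∈ K
      · simp only [Set.indicator_of_mem hx]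
        exact lintegral_sub_left_eq_self k x
      · simp [Set.indicator_of_notMem hx]
    simp only [this, lintegral_indicator hKm, setLIntegral_const]
  have hI2 : ∫⁻ x, ∫⁻ y, K.indicator (fun _ => k (x - y)) y = (∫⁻ z, k z) * volume K := by
    rw [lintegral_lintegral_swap hm2.aemeasurable]
    have : ∀ y, ∫⁻ x, K.indicator (fun _ => k (x - y)) y =
        K.indicator (fun _ => ∫⁻ z, k z) y := by
      intro y
      by_cases hy : y ∈ K
      · simp only [Set.indicator_of_mem hy]
        exact lintegral_sub_right_eq_self k y
      · simp [Set.indicator_of_notMem hy]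
    simp only [this, lintegral_indicator hKm, setLIntegral_const]
  have hfin : (∫⁻ z, k z) * volume K + (∫⁻ z, k z) * volume K ≠ ⊤ :=
    ENNReal.add_ne_top.2 ⟨ENNReal.mul_ne_top hkI hKfin, ENNReal.mul_ne_top hkI hKfin⟩
  refine ne_top_of_le_ne_top hfin ?_
  calc gagliardo s p u ≤ ∫⁻ x, ∫⁻ y, (K.indicator (fun _ => k (x - y)) x +
        K.indicator (fun _ => k (x - y)) y) :=
      lintegral_mono fun x => lintegral_mono fun y => hbound x y
    _ = ∫⁻ x, (∫⁻ y, K.indicator (fun _ => k (x - y)) x) +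
          ∫⁻ y, K.indicator (fun _ => k (x - y)) y :=
      lintegral_congr fun x => lintegral_add_left (hm1.comp (by fun_prop : Measurable
        fun y : EuclideanSpace ℝ (Fin N) => (x, y))) _
    _ = _ := by rw [lintegral_add_left hm1.lintegral_prod_right', hI1, hI2]

/-! ### Convergence in the space `D_0^{s,p}` -/

theorem tendsto_eLpNorm_of_tendsto_eLpNorm_sub {α : Type*} [MeasurableSpace α] {μ : Measure α}
    {q : ℝ≥0∞} (hq : 1 ≤ q) {f : ℕ → α → ℝ} {g : α → ℝ} (hf : ∀ n, MemLp (f n) q μ)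
    (hg : MemLp g q μ) (h : Tendsto (fun n => eLpNorm (f n - g) q μ) atTop (𝓝 0)) :
    Tendsto (fun n => eLpNorm (f n) q μ) atTop (𝓝 (eLpNorm g q μ)) := by
  have : Fact (1 ≤ q) := ⟨hq⟩
  have h1 := ((Lp.tendsto_Lp_iff_tendsto_eLpNorm'' f hf g hg).2 h).norm
  simp only [Lp.norm_toLp] at h1
  exact (ENNReal.tendsto_toReal_iff (fun n => (hf n).2.ne) hg.2.ne).1 h1

theorem ENNReal.tendsto_zero_of_rpow {f : ℕ → ℝ≥0∞} {p : ℝ} (hp : 0 < p)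
    (h : Tendsto (fun n => f n ^ p) atTop (𝓝 0)) : Tendsto f atTop (𝓝 0) := by
  have h1 := h.ennrpow_const p⁻¹
  rw [ENNReal.zero_rpow_of_pos (inv_pos.2 hp)] at h1
  simpa only [← ENNReal.rpow_mul, mul_inv_cancel₀ hp.ne', ENNReal.rpow_one] using h1

theorem one_le_ofReal {p : ℝ} (hp : 1 < p) : 1 ≤ ENNReal.ofReal p := by
  rw [← ENNReal.ofReal_one]; exact ENNReal.ofReal_le_ofReal hp.le

theorem IsTestFunction.memLp_fracQuotient {N : ℕ} (hN : 1 ≤ N) {s p : ℝ} (hs0 : 0 < s)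
    (hs1 : s < 1) (hp : 0 < p) {U : Set (EuclideanSpace ℝ (Fin N))}
    {u : EuclideanSpace ℝ (Fin N) → ℝ} (hu : IsTestFunction U u) :
    MemLp (fracQuotient s p u) (ENNReal.ofReal p) volume := by
  refine ⟨aestronglyMeasurable_fracQuotient hu.aestronglyMeasurable, ?_⟩
  have h := hu.gagliardo_ne_top hN hs0 hs1 hp
  rw [gagliardo_eq_eLpNorm hp hu.aestronglyMeasurable] at h
  rw [lt_top_iff_ne_top]
  intro hcon
  rw [hcon, ENNReal.top_rpow_of_pos hp] at h
  exact h rfl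

theorem MemLp.of_tendsto_eLpNorm_sub {α : Type*} [MeasurableSpace α] {μ : Measure α}
    {q : ℝ≥0∞} {f : ℕ → α → ℝ} {g : α → ℝ} (hf : ∀ n, MemLp (f n) q μ)
    (hg : AEStronglyMeasurable g μ) (h : Tendsto (fun n => eLpNorm (f n - g) q μ) atTop (𝓝 0)) :
    MemLp g q μ := by
  obtain ⟨n, hn⟩ := (h.eventually_lt_const ENNReal.zero_lt_top).exists
  have h1 : MemLp (f n - g) q μ := ⟨(hf n).1.sub hg, hn⟩
  simpa using (hf n).sub h1

section Approximation

variable {N : ℕ} {s p : ℝ} {U : Set (EuclideanSpace ℝ (Fin N))}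
  {v : EuclideanSpace ℝ (Fin N) → ℝ} {φ : ℕ → EuclideanSpace ℝ (Fin N) → ℝ}

theorem tendsto_eLpNorm_fracQuotient_sub (hp : 1 < p) (hv : AEStronglyMeasurable v volume)
    (hφ : ∀ n, IsTestFunction U (φ n))
    (hG : Tendsto (fun n => gagliardo s p (φ n - v)) atTop (𝓝 0)) :
    Tendsto (fun n => eLpNorm (fracQuotient s p (φ n) - fracQuotient s p v)
      (ENNReal.ofReal p) volume) atTop (𝓝 0) := by
  have hp0 : 0 < p := by linarith
  refine ENNReal.tendsto_zero_of_rpow hp0 (hG.congr fun n => ?_)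
  rw [gagliardo_eq_eLpNorm hp0 ((hφ n).aestronglyMeasurable.sub hv), fracQuotient_sub]

theorem memLp_fracQuotient_of_tendsto (hN : 1 ≤ N) (hs0 : 0 < s) (hs1 : s < 1) (hp : 1 < p)
    (hv : AEStronglyMeasurable v volume) (hφ : ∀ n, IsTestFunction U (φ n))
    (hG : Tendsto (fun n => gagliardo s p (φ n - v)) atTop (𝓝 0)) :
    MemLp (fracQuotient s p v) (ENNReal.ofReal p) volume :=
  MemLp.of_tendsto_eLpNorm_sub
    (fun n => (hφ n).memLp_fracQuotient hN hs0 hs1 (zero_lt_one.trans hp))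
    (aestronglyMeasurable_fracQuotient hv) (tendsto_eLpNorm_fracQuotient_sub hp hv hφ hG)

theorem tendsto_gagliardo (hN : 1 ≤ N) (hs0 : 0 < s) (hs1 : s < 1) (hp : 1 < p)
    (hv : AEStronglyMeasurable v volume) (hφ : ∀ n, IsTestFunction U (φ n))
    (hG : Tendsto (fun n => gagliardo s p (φ n - v)) atTop (𝓝 0)) :
    Tendsto (fun n => (gagliardo s p (φ n)).toReal) atTop (𝓝 (gagliardo s p v).toReal) := by
  have hp0 : 0 < p := by linarith
  have hmem := memLp_fracQuotient_of_tendsto hN hs0 hs1 hp hv hφ hG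
  have h1 := tendsto_eLpNorm_of_tendsto_eLpNorm_sub (one_le_ofReal hp)
    (fun n => (hφ n).memLp_fracQuotient hN hs0 hs1 hp0) hmem
    (tendsto_eLpNorm_fracQuotient_sub hp hv hφ hG)
  rw [gagliardo_eq_eLpNorm hp0 hv]
  refine (ENNReal.tendsto_toReal (ENNReal.rpow_ne_top_of_nonneg hp0.le hmem.2.ne)).comp ?_
  refine (h1.ennrpow_const p).congr fun n => ?_
  rw [gagliardo_eq_eLpNorm hp0 (hφ n).aestronglyMeasurable]

theorem tendsto_setIntegral_of_tendsto_eLpNorm (hU : volume U ≠ ⊤) (hp : 1 < p)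
    (hv : AEStronglyMeasurable v volume) (hφ : ∀ n, IsTestFunction U (φ n))
    (hL : Tendsto (fun n => eLpNorm (φ n - v) (ENNReal.ofReal p) volume) atTop (𝓝 0)) :
    IntegrableOn v U ∧ Tendsto (fun n => ∫ x in U, φ n x) atTop (𝓝 (∫ x in U, v x)) := by
  have hfin : IsFiniteMeasure (volume.restrict U) := ⟨by simpa using hU.lt_top⟩
  have hmem : MemLp v (ENNReal.ofReal p) volume :=
    MemLp.of_tendsto_eLpNorm_sub (fun n => (hφ n).memLp _) hv hL
  have hint : IntegrableOn v U := (hmem.restrict U).integrable (one_le_ofReal hp)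
  refine ⟨hint, tendsto_integral_of_L1' v hint.aestronglyMeasurable
    (Eventually.of_forall fun n => (((hφ n).memLp 1).restrict U).integrable le_rfl) ?_⟩
  set c : ℝ≥0∞ := (volume.restrict U) Set.univ ^
    (1 / (1 : ℝ≥0∞).toReal - 1 / (ENNReal.ofReal p).toReal) with hc
  have hc' : c ≠ ⊤ := by
    refine ENNReal.rpow_ne_top_of_nonneg ?_ (measure_ne_top _ _)
    rw [ENNReal.toReal_ofReal (by linarith), ENNReal.toReal_one, div_one, sub_nonneg,
      div_le_one (by linarith)]
    exact hp.le
  have hlim : Tendsto (fun n => eLpNorm (φ n - v) (ENNReal.ofReal p) volume * c) atTop (𝓝 0) := by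
    simpa using ENNReal.Tendsto.mul_const hL (Or.inr hc')
  refine tendsto_of_tendsto_of_tendsto_of_le_of_le tendsto_const_nhds hlim (fun n => zero_le)
    fun n => ?_
  refine (eLpNorm_le_eLpNorm_mul_rpow_measure_univ (one_le_ofReal hp)
    ((hφ n).aestronglyMeasurable.sub hv).restrict).trans ?_
  gcongr
  exact Measure.restrict_le_self

theorem tendsto_torsionEnergy (hN : 1 ≤ N) (hs0 : 0 < s) (hs1 : s < 1) (hp : 1 < p)
    (hU : volume U ≠ ⊤)
    (hv : AEStronglyMeasurable v volume) (hφ : ∀ n, IsTestFunction U (φ n))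
    (hL : Tendsto (fun n => eLpNorm (φ n - v) (ENNReal.ofReal p) volume) atTop (𝓝 0))
    (hG : Tendsto (fun n => gagliardo s p (φ n - v)) atTop (𝓝 0)) :
    Tendsto (fun n => torsionEnergy s p U (φ n)) atTop (𝓝 (torsionEnergy s p U v)) :=
  ((tendsto_gagliardo hN hs0 hs1 hp hv hφ hG).const_mul _).sub
    (tendsto_setIntegral_of_tendsto_eLpNorm hU hp hv hφ hL).2

end Approximation

theorem IsTestFunction.memD0 {N : ℕ} {s p : ℝ} (hp : 1 < p)
    {U : Set (EuclideanSpace ℝ (Fin N))} {u : EuclideanSpace ℝ (Fin N) → ℝ}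
    (hu : IsTestFunction U u) : MemD0 s p U u := by
  have hp0 : p ≠ 0 := by linarith
  refine ⟨hu.aestronglyMeasurable, fun _ => u, fun _ => hu, ?_, ?_⟩
  · simp
  · simp [gagliardo, Real.zero_rpow hp0]

theorem MemD0.const_smul {N : ℕ} {s p : ℝ}
    {U : Set (EuclideanSpace ℝ (Fin N))} {u : EuclideanSpace ℝ (Fin N) → ℝ}
    (hu : MemD0 s p U u) (c : ℝ) : MemD0 s p U (c • u) := by
  obtain ⟨hm, φ, hφ, hL, hG⟩ := hu
  refine ⟨hm.const_smul c, fun n => c • φ n, fun n => (hφ n).smul c, ?_, ?_⟩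
  · simp only [← smul_sub, eLpNorm_const_smul]
    simpa using ENNReal.Tendsto.const_mul hL (Or.inr (enorm_ne_top (x := c)))
  · simp only [← smul_sub, gagliardo_smul]
    simpa using ENNReal.Tendsto.const_mul hG (Or.inr (ENNReal.ofReal_ne_top (r := |c| ^ p)))

/-! ### Coercivity of the torsion energy -/

/-- The fractional Poincaré inequality on bounded sets. A point of the ball sees a ball of radius
`R` on which the function vanishes, at distance at most `4 R`. -/
theorem exists_mul_lintegral_le_gagliardo {N : ℕ} (hN : 1 ≤ N) {s p : ℝ} (hs0 : 0 < s)
    (hp : 0 < p) {R : ℝ} (hR : 0 < R) :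
    ∃ c : ℝ, 0 < c ∧ ∀ u : EuclideanSpace ℝ (Fin N) → ℝ,
      (∀ x, x ∉ Metric.ball 0 R → u x = 0) →
        ENNReal.ofReal c * ∫⁻ x, ENNReal.ofReal (|u x| ^ p) ≤ gagliardo s p u := by
  have : Nonempty (Fin N) := ⟨⟨0, hN⟩⟩
  obtain ⟨y₀, hy₀⟩ := exists_norm_eq (EuclideanSpace ℝ (Fin N)) (by positivity : 0 ≤ 2 * R)
  set B := Metric.ball y₀ R with hB
  have hBpos : 0 < volume.real B :=
    ENNReal.toReal_pos (Metric.measure_ball_pos _ _ hR).ne' measure_ball_lt_top.ne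
  set q : ℝ := (N : ℝ) + s * p with hq
  have hq0 : 0 ≤ q := by positivity
  have hRq : 0 < (4 * R) ^ q := by positivity
  refine ⟨volume.real B / (4 * R) ^ q, by positivity, fun u hu => ?_⟩
  rw [← lintegral_const_mul' _ _ ENNReal.ofReal_ne_top, gagliardo]
  refine lintegral_mono fun x => ?_
  by_cases hx : x ∈ Metric.ball (0 : EuclideanSpace ℝ (Fin N)) R
  swap
  · simp [hu x hx, Real.zero_rpow hp.ne']
  rw [mem_ball_zero_iff] at hx
  calc ENNReal.ofReal (volume.real B / (4 * R) ^ q) * ENNReal.ofReal (|u x| ^ p)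
      = ∫⁻ _ in B, ENNReal.ofReal (|u x| ^ p / (4 * R) ^ q) := by
        rw [setLIntegral_const, ← ENNReal.ofReal_mul (by positivity),
          ← ENNReal.ofReal_toReal (measure_ball_lt_top (μ := volume) (x := y₀) (r := R)).ne,
          ← ENNReal.ofReal_mul (by positivity)]
        congr 1
        rw [hB, Measure.real]
        ring
    _ ≤ ∫⁻ y in B, ENNReal.ofReal (|u x - u y| ^ p / ‖x - y‖ ^ q) := by
        refine setLIntegral_mono' Metric.isOpen_ball.measurableSet fun y hy => ?_
        refine ENNReal.ofReal_le_ofReal ?_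
        rw [hB, Metric.mem_ball, dist_eq_norm] at hy
        have h1 : ‖y₀‖ ≤ ‖y‖ + ‖y - y₀‖ := by
          have := norm_sub_le y (y - y₀); simpa using this
        have h2 : ‖y‖ ≤ ‖y₀‖ + ‖y - y₀‖ := by
          have := norm_add_le y₀ (y - y₀); simpa using this
        have h3 : ‖x - y‖ ≤ ‖x‖ + ‖y‖ := norm_sub_le x y
        have h4 : ‖y‖ ≤ ‖x‖ + ‖x - y‖ := by
          have := norm_sub_le x (x - y); simpa using this
        have hy0 : u y = 0 := hu y (by rw [mem_ball_zero_iff]; linarith)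
        have hpos : 0 < ‖x - y‖ := by linarith
        rw [hy0, sub_zero]
        gcongr
        linarith
    _ ≤ _ := setLIntegral_le_lintegral _ _

/-- Young's inequality, with a small constant in front of the power. -/
theorem exists_le_mul_rpow_add {p δ : ℝ} (hp : 1 < p) (hδ : 0 < δ) :
    ∃ K : ℝ, 0 ≤ K ∧ ∀ a : ℝ, a ≤ δ * |a| ^ p + K := by
  refine ⟨(δ⁻¹) ^ (p - 1)⁻¹, by positivity, fun a => ?_⟩
  set M := (δ⁻¹) ^ (p - 1)⁻¹ with hM
  have hM0 : 0 < M := by positivity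
  have hMp : M ^ (p - 1) = δ⁻¹ := by
    rw [hM, ← Real.rpow_mul (by positivity), inv_mul_cancel₀ (by linarith), Real.rpow_one]
  rcases le_total |a| M with h | h
  · have := le_abs_self a
    have : 0 ≤ δ * |a| ^ p := by positivity
    linarith
  · have ha : 0 < |a| := hM0.trans_le h
    have h1 : |a| ^ p = |a| * |a| ^ (p - 1) := by
      rw [← Real.rpow_one_add' ha.le (by linarith)]; congr 1; ring
    have h2 : δ⁻¹ ≤ |a| ^ (p - 1) := by
      rw [← hMp]; exact Real.rpow_le_rpow hM0.le h (by linarith)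
    have h3 : |a| ≤ δ * |a| ^ p := by
      rw [h1]
      calc |a| = δ * (|a| * δ⁻¹) := by field_simp
        _ ≤ _ := by gcongr
    have := le_abs_self a
    linarith

theorem exists_torsionEnergy_ge {N : ℕ} (hN : 1 ≤ N) {s p : ℝ} (hs0 : 0 < s) (hs1 : s < 1)
    (hp : 1 < p) {U : Set (EuclideanSpace ℝ (Fin N))} {R : ℝ} (hR : 0 < R)
    (hU : U ⊆ Metric.ball 0 R) :
    ∃ C : ℝ, ∀ u, IsTestFunction U u →
      1 / (2 * p) * (gagliardo s p u).toReal - C ≤ torsionEnergy s p U u := by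
  have hp0 : 0 < p := by linarith
  obtain ⟨c, hc, hPoin⟩ := exists_mul_lintegral_le_gagliardo hN hs0 hp0 hR
  obtain ⟨K, hK0, hK⟩ := exists_le_mul_rpow_add hp (δ := c / (2 * p)) (by positivity)
  have hUfin : volume U ≠ ⊤ := ne_top_of_le_ne_top measure_ball_lt_top.ne (measure_mono hU)
  refine ⟨K * volume.real U, fun u hu => ?_⟩
  have hIp : Integrable (fun x => |u x| ^ p) volume := by
    have := (hu.memLp (ENNReal.ofReal p)).integrable_norm_rpow (by simpa using hp0)
      ENNReal.ofReal_ne_top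
    simpa [ENNReal.toReal_ofReal hp0.le] using this
  have hP : c * ∫ x, |u x| ^ p ≤ (gagliardo s p u).toReal := by
    have h1 := hPoin u fun x hx => hu.eq_zero fun h => hx (hU h)
    rw [← ofReal_integral_eq_lintegral_ofReal hIp
      (Eventually.of_forall fun x => by positivity), ← ENNReal.ofReal_mul hc.le] at h1
    exact (ENNReal.ofReal_le_iff_le_toReal (hu.gagliardo_ne_top hN hs0 hs1 hp0)).1 h1
  have hI : ∫ x in U, u x ≤ c / (2 * p) * (∫ x, |u x| ^ p) + K * volume.real U := by
    have hcK : IntegrableOn (fun _ : EuclideanSpace ℝ (Fin N) => K) U := integrableOn_const hUfin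
    calc ∫ x in U, u x ≤ ∫ x in U, (c / (2 * p) * |u x| ^ p + K) :=
          integral_mono (memLp_one_iff_integrable.1 ((hu.memLp 1).restrict U))
            ((hIp.restrict.const_mul _).add hcK) fun x => hK (u x)
      _ = c / (2 * p) * (∫ x in U, |u x| ^ p) + K * volume.real U := by
          rw [integral_add (hIp.restrict.const_mul _) hcK, integral_const_mul, setIntegral_const,
            smul_eq_mul, mul_comm K]
      _ ≤ _ := by
          gcongr ?_ + _
          exact mul_le_mul_of_nonneg_left (setIntegral_le_integral hIp
            (Eventually.of_forall fun x => by positivity)) (by positivity)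
  rw [torsionEnergy]
  have h2 : c / (2 * p) * ∫ x, |u x| ^ p ≤ 1 / (2 * p) * (gagliardo s p u).toReal := by
    rw [div_mul_eq_mul_div, one_div_mul_eq_div]; gcongr
  have h3 : 1 / p * (gagliardo s p u).toReal = 1 / (2 * p) * (gagliardo s p u).toReal +
    1 / (2 * p) * (gagliardo s p u).toReal := by field_simp; ring
  linarith

/-! ### Existence of the minimiser -/

theorem abs_half_add_rpow_lt {p : ℝ} (hp : 1 < p) {a b : ℝ} (hab : a ≠ b) :
    |(a + b) / 2| ^ p < (|a| ^ p + |b| ^ p) / 2 := by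
  have hp0 : 0 < p := by linarith
  by_cases h : |a| = |b|
  · have hb : a = -b := (abs_eq_abs.1 h).resolve_left hab
    have hb0 : b ≠ 0 := by rintro rfl; exact hab (by simpa using hb)
    rw [hb, neg_add_cancel, zero_div, abs_zero, Real.zero_rpow hp0.ne', abs_neg]
    positivity
  · have h1 := (strictConvexOn_rpow hp).2 (Set.mem_Ici.2 (abs_nonneg a))
      (Set.mem_Ici.2 (abs_nonneg b)) h (by norm_num : (0 : ℝ) < 1 / 2)
      (by norm_num : (0 : ℝ) < 1 / 2) (by norm_num)
    simp only [smul_eq_mul] at h1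
    have h2 : |(a + b) / 2| ≤ 1 / 2 * |a| + 1 / 2 * |b| := by
      rw [abs_div, abs_two]; linarith [abs_add_le a b]
    calc |(a + b) / 2| ^ p ≤ (1 / 2 * |a| + 1 / 2 * |b|) ^ p := by gcongr
      _ < _ := h1
      _ = _ := by ring

/-- A quantitative form of the strict convexity of `|·| ^ p`, valid for every `p > 1`. By
homogeneity it suffices to consider the sphere `|a| ^ p + |b| ^ p = 1`, where the convexity defect
is bounded below on the compact set of pairs with `|a - b| ^ p ≥ δ`. -/
theorem exists_abs_sub_rpow_le {p δ : ℝ} (hp : 1 < p) (hδ : 0 < δ) :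
    ∃ K : ℝ, 0 ≤ K ∧ ∀ a b : ℝ, |a - b| ^ p + K * |(a + b) / 2| ^ p ≤
      (K / 2 + δ) * (|a| ^ p + |b| ^ p) := by
  have hp0 : 0 < p := by linarith
  have hc : ∀ f : ℝ × ℝ → ℝ, Continuous f → Continuous fun z => |f z| ^ p := fun f hf =>
    hf.abs.rpow_const fun _ => Or.inr hp0.le
  suffices hsphere : ∃ K : ℝ, 0 ≤ K ∧ ∀ a b : ℝ, |a| ^ p + |b| ^ p = 1 →
      |a - b| ^ p + K * |(a + b) / 2| ^ p ≤ K / 2 + δ by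
    obtain ⟨K, hK0, hK⟩ := hsphere
    refine ⟨K, hK0, fun a b => ?_⟩
    set r := |a| ^ p + |b| ^ p with hr
    have hr0 : 0 ≤ r := by positivity
    rcases hr0.eq_or_lt with h | h
    · have ha : |a| ^ p = 0 := le_antisymm (by have : 0 ≤ |b| ^ p := by positivity
                                               linarith) (by positivity)
      have hb : |b| ^ p = 0 := by rw [ha] at hr; linarith
      rw [Real.rpow_eq_zero (abs_nonneg _) hp0.ne', abs_eq_zero] at ha hb
      simp [ha, hb, Real.zero_rpow hp0.ne', ← h]
    · set t := r ^ p⁻¹ with ht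
      have ht0 : 0 < t := by positivity
      have htp : t ^ p = r := Real.rpow_inv_rpow hr0 hp0.ne'
      have hdiv : ∀ x : ℝ, |x / t| ^ p = |x| ^ p / r := fun x => by
        rw [abs_div, abs_of_pos ht0, Real.div_rpow (abs_nonneg _) ht0.le, htp]
      have h1 := hK (a / t) (b / t) (by rw [hdiv, hdiv, ← add_div, ← hr, div_self h.ne'])
      rw [← sub_div, ← add_div, div_right_comm, hdiv, hdiv, ← mul_div_assoc, ← add_div,
        div_le_iff₀ h] at h1
      exact h1
  set S : Set (ℝ × ℝ) := {z | |z.1| ^ p + |z.2| ^ p = 1 ∧ δ ≤ |z.1 - z.2| ^ p} with hS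
  have hle1 : ∀ a b : ℝ, |a| ^ p + |b| ^ p = 1 → |a| ≤ 1 ∧ |b| ≤ 1 := by
    intro a b h
    have ha : |a| ^ p ≤ 1 ^ p := by
      rw [Real.one_rpow]; have : 0 ≤ |b| ^ p := by positivity
      linarith
    have hb : |b| ^ p ≤ 1 ^ p := by
      rw [Real.one_rpow]; have : 0 ≤ |a| ^ p := by positivity
      linarith
    exact ⟨(Real.rpow_le_rpow_iff (abs_nonneg _) zero_le_one hp0).1 ha,
      (Real.rpow_le_rpow_iff (abs_nonneg _) zero_le_one hp0).1 hb⟩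
  have hScomp : IsCompact S := by
    refine Metric.isCompact_of_isClosed_isBounded ?_ ?_
    · exact (isClosed_eq ((hc _ continuous_fst).add (hc _ continuous_snd)) continuous_const).inter
        (isClosed_le continuous_const (hc _ (continuous_fst.sub continuous_snd)))
    · refine (Metric.isBounded_closedBall (x := (0 : ℝ × ℝ)) (r := 1)).subset fun z hz => ?_
      rw [mem_closedBall_zero_iff, Prod.norm_def]
      exact max_le (hle1 _ _ hz.1).1 (hle1 _ _ hz.1).2
  have hmid : ∀ a b : ℝ, |a| ^ p + |b| ^ p = 1 → |(a + b) / 2| ^ p ≤ 1 / 2 := by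
    intro a b h
    rcases eq_or_ne a b with rfl | hne
    · rw [add_self_div_two]; linarith
    · rw [← h]; exact (abs_half_add_rpow_lt hp hne).le
  rcases S.eq_empty_or_nonempty with hSe | hSne
  · refine ⟨0, le_rfl, fun a b h => ?_⟩
    have : ¬ δ ≤ |a - b| ^ p := fun hcon => by
      have : (a, b) ∈ S := ⟨h, hcon⟩
      rw [hSe] at this; exact this
    linarith
  · obtain ⟨z₀, hz₀, hmin⟩ := hScomp.exists_isMinOn hSne
      (((continuous_const (y := (1 / 2 : ℝ))).sub
        (hc _ ((continuous_fst.add continuous_snd).div_const 2))).continuousOn)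
    set m : ℝ := 1 / 2 - |(z₀.1 + z₀.2) / 2| ^ p with hm
    have hm0 : 0 < m := by
      have hne : z₀.1 ≠ z₀.2 := fun h => by
        have := hz₀.2
        rw [h, sub_self, abs_zero, Real.zero_rpow hp0.ne'] at this
        linarith
      have := abs_half_add_rpow_lt hp hne
      rw [hz₀.1] at this
      linarith
    refine ⟨2 ^ p / m, by positivity, fun a b h => ?_⟩
    by_cases hab : δ ≤ |a - b| ^ p
    · have h1 : m ≤ 1 / 2 - |(a + b) / 2| ^ p := hmin (show (a, b) ∈ S from ⟨h, hab⟩)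
      have h2 : |a - b| ≤ 2 := by
        have := abs_sub a b
        have := hle1 a b h
        linarith
      have h3 : |a - b| ^ p ≤ 2 ^ p := by gcongr
      have h4 : (2 : ℝ) ^ p = 2 ^ p / m * m := by field_simp
      have h5 : 2 ^ p / m * m ≤ 2 ^ p / m * (1 / 2 - |(a + b) / 2| ^ p) := by gcongr
      linarith
    · have h1 : 2 ^ p / m * |(a + b) / 2| ^ p ≤ 2 ^ p / m * (1 / 2) := by
        gcongr; exact hmid a b h
      linarith

theorem IsTestFunction.integrable_abs_fracQuotient_rpow {N : ℕ} (hN : 1 ≤ N) {s p : ℝ}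
    (hs0 : 0 < s) (hs1 : s < 1) (hp : 0 < p) {U : Set (EuclideanSpace ℝ (Fin N))}
    {u : EuclideanSpace ℝ (Fin N) → ℝ} (hu : IsTestFunction U u) :
    Integrable (fun z => |fracQuotient s p u z| ^ p) volume := by
  have := (hu.memLp_fracQuotient hN hs0 hs1 hp).integrable_norm_rpow (by simpa using hp)
    ENNReal.ofReal_ne_top
  simpa [ENNReal.toReal_ofReal hp.le] using this

theorem IsTestFunction.toReal_gagliardo {N : ℕ} {s p : ℝ}
    (hp : 0 < p) {U : Set (EuclideanSpace ℝ (Fin N))}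
    {u : EuclideanSpace ℝ (Fin N) → ℝ} (hu : IsTestFunction U u) :
    (gagliardo s p u).toReal = ∫ z, |fracQuotient s p u z| ^ p := by
  have hm : AEMeasurable (fun z => |fracQuotient s p u z|) volume :=
    (aestronglyMeasurable_fracQuotient hu.aestronglyMeasurable).norm.aemeasurable
  rw [gagliardo_eq_lintegral hp hu.aestronglyMeasurable,
    integral_eq_lintegral_of_nonneg_ae (Eventually.of_forall fun z => by positivity)
      (hm.pow_const p).aestronglyMeasurable]

/-- If two test functions have almost minimal energy, then so has their mean, and quantitative
strict convexity forces the two functions to be close in the Gagliardo seminorm. -/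
theorem exists_gagliardo_sub_le {N : ℕ} (hN : 1 ≤ N) {s p : ℝ} (hs0 : 0 < s) (hs1 : s < 1)
    (hp : 1 < p) {δ : ℝ} (hδ : 0 < δ) (U : Set (EuclideanSpace ℝ (Fin N))) :
    ∃ K : ℝ, 0 ≤ K ∧ ∀ u v, IsTestFunction U u → IsTestFunction U v →
      (gagliardo s p (u - v)).toReal ≤
        K * ((torsionEnergy s p U u + torsionEnergy s p U v) / 2 -
          torsionEnergy s p U ((1 / 2 : ℝ) • (u + v))) +
        δ * ((gagliardo s p u).toReal + (gagliardo s p v).toReal) := by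
  have hp0 : 0 < p := by linarith
  obtain ⟨K, hK0, hK⟩ := exists_abs_sub_rpow_le hp hδ
  refine ⟨K * p, by positivity, fun u v hu hv => ?_⟩
  have hmid := (hu.add hv).smul (1 / 2)
  have hlin : ∫ x in U, ((1 / 2 : ℝ) • (u + v)) x =
      ((∫ x in U, u x) + ∫ x in U, v x) / 2 := by
    have hiu : IntegrableOn u U := memLp_one_iff_integrable.1 ((hu.memLp 1).restrict U)
    have hiv : IntegrableOn v U := memLp_one_iff_integrable.1 ((hv.memLp 1).restrict U)
    simp only [Pi.smul_apply, Pi.add_apply, smul_eq_mul]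
    rw [integral_const_mul, integral_add hiu hiv]
    ring
  have hI := fun {w} (hw : IsTestFunction U w) =>
    hw.integrable_abs_fracQuotient_rpow hN hs0 hs1 hp0
  have key : (gagliardo s p (u - v)).toReal +
      K * (gagliardo s p ((1 / 2 : ℝ) • (u + v))).toReal ≤
      (K / 2 + δ) * ((gagliardo s p u).toReal + (gagliardo s p v).toReal) := by
    rw [hu.toReal_gagliardo hp0, hv.toReal_gagliardo hp0, (hu.sub hv).toReal_gagliardo hp0,
      hmid.toReal_gagliardo hp0, ← integral_const_mul, ← integral_add (hI (hu.sub hv))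
        ((hI hmid).const_mul K), ← integral_add (hI hu) (hI hv), ← integral_const_mul]
    refine integral_mono ((hI (hu.sub hv)).add ((hI hmid).const_mul K))
      (((hI hu).add (hI hv)).const_mul _) fun z => ?_
    have h1 : fracQuotient s p ((1 / 2 : ℝ) • (u + v)) z =
        (fracQuotient s p u z + fracQuotient s p v z) / 2 := by
      simp only [fracQuotient, Pi.smul_apply, Pi.add_apply, smul_eq_mul]
      ring
    simp only [h1, fracQuotient_sub, Pi.sub_apply]
    exact hK _ _
  simp only [torsionEnergy, hlin]
  have h2 : K * p * ((1 / p * (gagliardo s p u).toReal - ∫ x in U, u x) +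
      (1 / p * (gagliardo s p v).toReal - ∫ x in U, v x)) / 2 -
      K * p * (1 / p * (gagliardo s p ((1 / 2 : ℝ) • (u + v))).toReal -
      ((∫ x in U, u x) + ∫ x in U, v x) / 2) =
      K / 2 * ((gagliardo s p u).toReal + (gagliardo s p v).toReal) -
        K * (gagliardo s p ((1 / 2 : ℝ) • (u + v))).toReal := by
    field_simp
    ring
  linarith

/-- The direct method: a minimising sequence of test functions is a Cauchy sequence in
`D_0^{s,p}(U)`, and its limit is a minimiser. -/
theorem exists_isTorsionMinimizer {N : ℕ} (hN : 1 ≤ N) {s p : ℝ} (hs0 : 0 < s) (hs1 : s < 1)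
    (hp : 1 < p) {U : Set (EuclideanSpace ℝ (Fin N))} {R : ℝ} (hR : 0 < R)
    (hU : U ⊆ Metric.ball 0 R) : ∃ w, IsTorsionMinimizer s p U w := by
  have hp0 : 0 < p := by linarith
  have hUfin : volume U ≠ ⊤ := ne_top_of_le_ne_top measure_ball_lt_top.ne (measure_mono hU)
  obtain ⟨c, hc, hPoin⟩ := exists_mul_lintegral_le_gagliardo hN hs0 hp0 hR
  obtain ⟨C, hC⟩ := exists_torsionEnergy_ge hN hs0 hs1 hp hR hU
  set S : Set ℝ := torsionEnergy s p U '' {u | IsTestFunction U u} with hS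
  have hSne : S.Nonempty := ⟨_, 0, IsTestFunction.zero U, rfl⟩
  have hSbdd : BddBelow S := by
    refine ⟨-C, ?_⟩
    rintro _ ⟨u, hu, rfl⟩
    have := hC u hu
    have h2 : 0 ≤ 1 / (2 * p) * (gagliardo s p u).toReal := by positivity
    linarith
  set m := sInf S with hm
  have hmle : ∀ u, IsTestFunction U u → m ≤ torsionEnergy s p U u := fun u hu =>
    csInf_le hSbdd ⟨u, hu, rfl⟩
  obtain ⟨J, -, hJlim, hJmem⟩ := exists_seq_tendsto_sInf hSne hSbdd
  choose φ hφ hφJ using hJmem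
  replace hφ : ∀ n, IsTestFunction U (φ n) := hφ
  obtain ⟨B, hB⟩ : ∃ B : ℝ, 0 ≤ B ∧ ∀ n, (gagliardo s p (φ n)).toReal ≤ B := by
    obtain ⟨b, hb⟩ := hJlim.bddAbove_range
    refine ⟨max 0 (2 * p * (b + C)), le_max_left _ _, fun n => le_max_of_le_right ?_⟩
    have h1 := hC _ (hφ n)
    rw [hφJ] at h1
    have h2 : J n ≤ b := hb ⟨n, rfl⟩
    have h3 : 1 / (2 * p) * (gagliardo s p (φ n)).toReal ≤ b + C := by linarith
    rwa [one_div_mul_eq_div, div_le_iff₀' (by positivity)] at h3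
  have hCauchy : ∀ ε : ℝ, 0 < ε → ∃ n₀, ∀ n ≥ n₀, ∀ k ≥ n₀,
      gagliardo s p (φ n - φ k) ≤ ENNReal.ofReal ε := by
    intro ε hε
    obtain ⟨K, hK0, hK⟩ := exists_gagliardo_sub_le hN hs0 hs1 hp
      (δ := ε / (4 * (B + 1))) (by have := hB.1; positivity) U
    have hη : 0 < ε / (2 * (K + 1)) := by positivity
    obtain ⟨n₀, hn₀⟩ := eventually_atTop.1 (hJlim.eventually_lt_const (lt_add_of_pos_right m hη))
    refine ⟨n₀, fun n hn k hk => ?_⟩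
    refine ENNReal.le_ofReal_iff_toReal_le
      (((hφ n).sub (hφ k)).gagliardo_ne_top hN hs0 hs1 hp0) hε.le |>.2 ?_
    refine (hK _ _ (hφ n) (hφ k)).trans ?_
    have h1 := hmle _ (((hφ n).add (hφ k)).smul (1 / 2))
    have h2 := hn₀ n hn
    have h3 := hn₀ k hk
    rw [← hφJ] at h2 h3
    have h4 : (torsionEnergy s p U (φ n) + torsionEnergy s p U (φ k)) / 2 -
        torsionEnergy s p U ((1 / 2 : ℝ) • (φ n + φ k)) ≤ ε / (2 * (K + 1)) := by linarith
    have h5 : K * (ε / (2 * (K + 1))) ≤ ε / 2 := by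
      rw [mul_div_assoc', div_le_div_iff₀ (by positivity) (by positivity)]
      nlinarith
    have hBn := hB.2 n
    have hBk := hB.2 k
    have h6 : ε / (4 * (B + 1)) * ((gagliardo s p (φ n)).toReal +
        (gagliardo s p (φ k)).toReal) ≤ ε / 2 := by
      have hB0 := hB.1
      calc _ ≤ ε / (4 * (B + 1)) * (2 * (B + 1)) := by
            gcongr; linarith
        _ = _ := by field_simp; norm_num
    have h7 := mul_le_mul_of_nonneg_left h4 hK0
    linarith
  -- the Poincaré inequality turns `hCauchy` into the Cauchy property in `L^p`
  have hq1 := one_le_ofReal hp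
  have : Fact (1 ≤ ENNReal.ofReal p) := ⟨hq1⟩
  have hmem : ∀ n, MemLp (φ n) (ENNReal.ofReal p) volume := fun n => (hφ n).memLp _
  have hCauchyLp : CauchySeq fun n => (hmem n).toLp (φ n) := by
    rw [Metric.cauchySeq_iff]
    intro ε hε
    obtain ⟨n₀, hn₀⟩ := hCauchy (c * (ε / 2) ^ p) (by positivity)
    refine ⟨n₀, fun n hn k hk => ?_⟩
    have h1 := (hPoin (φ n - φ k) fun x hx => ((hφ n).sub (hφ k)).eq_zero fun h => hx (hU h)).trans
      (hn₀ n hn k hk)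
    rw [lintegral_ofReal_abs_rpow hp0, ENNReal.ofReal_mul hc.le,
      ENNReal.mul_le_mul_iff_right (by simpa using hc) ENNReal.ofReal_ne_top,
      ← ENNReal.ofReal_rpow_of_nonneg (by positivity) hp0.le,
      ENNReal.rpow_le_rpow_iff hp0] at h1
    rw [dist_eq_norm, ← MemLp.toLp_sub, Lp.norm_toLp]
    exact (ENNReal.toReal_le_of_le_ofReal (by positivity) h1).trans_lt (by linarith)
  obtain ⟨w', hw⟩ := cauchySeq_tendsto_of_complete hCauchyLp
  obtain ⟨w, hww'⟩ : ∃ w : EuclideanSpace ℝ (Fin N) → ℝ, w = w' := ⟨w', rfl⟩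
  have hwm : AEStronglyMeasurable w volume := hww' ▸ Lp.aestronglyMeasurable w'
  have hL : Tendsto (fun n => eLpNorm (φ n - w) (ENNReal.ofReal p) volume) atTop (𝓝 0) := by
    refine ((Lp.tendsto_Lp_iff_tendsto_eLpNorm' _ _).1 hw).congr fun n => ?_
    rw [hww']
    exact eLpNorm_congr_ae ((hmem n).coeFn_toLp.sub EventuallyEq.rfl)
  obtain ⟨ns, hns, hae⟩ := (tendstoInMeasure_of_tendsto_eLpNorm (by simpa using hp0)
    (fun n => (hφ n).aestronglyMeasurable) hwm hL).exists_seq_tendsto_ae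
  -- the Gagliardo seminorm is lower semicontinuous under a.e. convergence, so the Cauchy property
  -- passes to the limit
  have hG : Tendsto (fun n => gagliardo s p (φ n - w)) atTop (𝓝 0) := by
    rw [ENNReal.tendsto_atTop_zero]
    intro ε hε
    obtain ⟨ε', hε', hle⟩ : ∃ ε' : ℝ, 0 < ε' ∧ ENNReal.ofReal ε' ≤ ε := by
      rcases eq_or_ne ε ⊤ with rfl | hne
      · exact ⟨1, one_pos, le_top⟩
      · exact ⟨ε.toReal, ENNReal.toReal_pos hε.ne' hne, (ENNReal.ofReal_toReal hne).le⟩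
    obtain ⟨n₀, hn₀⟩ := hCauchy ε' hε'
    refine ⟨n₀, fun n hn => le_trans ?_ hle⟩
    rw [gagliardo_eq_eLpNorm hp0 ((hφ n).aestronglyMeasurable.sub hwm),
      ← ENNReal.le_rpow_inv_iff hp0]
    refine Lp.eLpNorm_le_of_ae_tendsto (u := atTop)
      (f := fun k => fracQuotient s p (φ n - φ (ns k))) ?_ (fun k =>
      aestronglyMeasurable_fracQuotient ((hφ n).sub (hφ _)).aestronglyMeasurable) ?_
    · filter_upwards [hns.tendsto_atTop.eventually_ge_atTop n₀] with k hk
      rw [ENNReal.le_rpow_inv_iff hp0,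
        ← gagliardo_eq_eLpNorm hp0 ((hφ n).sub (hφ _)).aestronglyMeasurable]
      exact hn₀ n hn _ hk
    · rw [Measure.volume_eq_prod]
      filter_upwards [Measure.quasiMeasurePreserving_fst.ae hae,
        Measure.quasiMeasurePreserving_snd.ae hae] with z h1 h2
      simp only [fracQuotient, Pi.sub_apply]
      exact ((tendsto_const_nhds.sub h1).sub (tendsto_const_nhds.sub h2)).div_const _
  have hJw : torsionEnergy s p U w = m := by
    refine tendsto_nhds_unique (tendsto_torsionEnergy hN hs0 hs1 hp hUfin hwm hφ hL hG) ?_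
    exact hJlim.congr fun n => (hφJ n).symm
  refine ⟨w, ⟨hwm, φ, hφ, hL, hG⟩, fun v hv => ?_⟩
  obtain ⟨hvm, ψ, hψ, hLv, hGv⟩ := hv
  rw [hJw]
  exact ge_of_tendsto (tendsto_torsionEnergy hN hs0 hs1 hp hUfin hvm hψ hLv hGv)
    (Eventually.of_forall fun n => hmle _ (hψ n))

/-! ### Hidden convexity: power means as competitors -/

/-- The weighted power mean `((1 - t) a ^ p + t b ^ p) ^ (1 / p)` of nonnegative reals. -/
noncomputable def powerMean (p t a b : ℝ) : ℝ := ((1 - t) * a ^ p + t * b ^ p) ^ p⁻¹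

section PowerMean

variable {p t a b c d : ℝ}

theorem powerMean_base_nonneg (ht0 : 0 ≤ t) (ht1 : t ≤ 1) (ha : 0 ≤ a) (hb : 0 ≤ b) :
    0 ≤ (1 - t) * a ^ p + t * b ^ p := by
  have : 0 ≤ 1 - t := by linarith
  positivity

theorem powerMean_rpow (hp : 0 < p) (ht0 : 0 ≤ t) (ht1 : t ≤ 1) (ha : 0 ≤ a) (hb : 0 ≤ b) :
    powerMean p t a b ^ p = (1 - t) * a ^ p + t * b ^ p :=
  Real.rpow_inv_rpow (powerMean_base_nonneg ht0 ht1 ha hb) hp.ne'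

theorem powerMean_self (hp : 0 < p) (ha : 0 ≤ a) : powerMean p t a a = a := by
  rw [powerMean, ← add_mul, sub_add_cancel, one_mul, Real.rpow_rpow_inv ha hp.ne']

theorem powerMean_mono (hp : 0 < p) (ht0 : 0 ≤ t) (ht1 : t ≤ 1) (ha : 0 ≤ a) (hb : 0 ≤ b)
    (hac : a ≤ c) (hbd : b ≤ d) : powerMean p t a b ≤ powerMean p t c d := by
  have h1 : 0 ≤ 1 - t := by linarith
  exact Real.rpow_le_rpow (powerMean_base_nonneg ht0 ht1 ha hb) (by gcongr) (by positivity)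

theorem continuous_powerMean (hp : 0 < p) :
    Continuous fun z : ℝ × ℝ => powerMean p t z.1 z.2 := by
  have h : ∀ f : ℝ × ℝ → ℝ, Continuous f → Continuous fun z => f z ^ p := fun f hf =>
    hf.rpow_const fun _ => Or.inr hp.le
  exact ((continuous_const.mul (h _ continuous_fst)).add
    (continuous_const.mul (h _ continuous_snd))).rpow_const fun _ => Or.inr (by positivity)

/-- Minkowski's inequality for a weighted `ℓ^p` norm on the plane. -/
theorem powerMean_add_le (hp : 1 < p) (ht0 : 0 ≤ t) (ht1 : t ≤ 1) (ha : 0 ≤ a) (hb : 0 ≤ b)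
    (hc : 0 ≤ c) (hd : 0 ≤ d) :
    powerMean p t (a + c) (b + d) ≤ powerMean p t a b + powerMean p t c d := by
  have hp0 : 0 < p := by linarith
  have h1 : 0 ≤ 1 - t := by linarith
  have hpow : ∀ r x : ℝ, 0 ≤ r → 0 ≤ x → (r ^ p⁻¹ * x) ^ p = r * x ^ p := fun r x hr hx => by
    rw [Real.mul_rpow (by positivity) hx, Real.rpow_inv_rpow hr hp0.ne']
  have h := Real.Lp_add_le_of_nonneg (s := (Finset.univ : Finset (Fin 2))) hp.le
    (f := ![(1 - t) ^ p⁻¹ * a, t ^ p⁻¹ * b]) (g := ![(1 - t) ^ p⁻¹ * c, t ^ p⁻¹ * d])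
    (by intro i _; fin_cases i <;> simp <;> positivity)
    (by intro i _; fin_cases i <;> simp <;> positivity)
  simp only [Fin.sum_univ_two, Matrix.cons_val_zero, Matrix.cons_val_one, ← mul_add, one_div] at h
  rwa [hpow _ _ h1 (by positivity), hpow _ _ ht0 (by positivity), hpow _ _ h1 ha,
    hpow _ _ ht0 hb, hpow _ _ h1 hc, hpow _ _ ht0 hd] at h

theorem abs_powerMean_sub_rpow_le (hp : 1 < p) (ht0 : 0 ≤ t) (ht1 : t ≤ 1) (ha : 0 ≤ a)
    (hb : 0 ≤ b) (hc : 0 ≤ c) (hd : 0 ≤ d) :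
    |powerMean p t a b - powerMean p t c d| ^ p ≤ (1 - t) * |a - c| ^ p + t * |b - d| ^ p := by
  have hp0 : 0 < p := by linarith
  have key : ∀ a b c d : ℝ, 0 ≤ a → 0 ≤ b → 0 ≤ c → 0 ≤ d →
      powerMean p t a b ≤ powerMean p t c d + powerMean p t |a - c| |b - d| := by
    intro a b c d ha hb hc hd
    refine (powerMean_mono hp0 ht0 ht1 ha hb (?_ : a ≤ c + |a - c|)
      (?_ : b ≤ d + |b - d|)).trans
      (powerMean_add_le hp ht0 ht1 hc hd (abs_nonneg _) (abs_nonneg _))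
    · linarith [le_abs_self (a - c)]
    · linarith [le_abs_self (b - d)]
  rw [← powerMean_rpow hp0 ht0 ht1 (abs_nonneg _) (abs_nonneg _)]
  refine Real.rpow_le_rpow (abs_nonneg _) (abs_le.2 ⟨?_, ?_⟩) hp0.le
  · have := key c d a b hc hd ha hb
    rw [abs_sub_comm c, abs_sub_comm d] at this
    linarith
  · have := key a b c d ha hb hc hd
    linarith

end PowerMean

theorem abs_sqrt_sq_add_sub_le (a b η : ℝ) :
    |√(a ^ 2 + η ^ 2) - √(b ^ 2 + η ^ 2)| ≤ |a - b| := by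
  rcases eq_or_ne (√(a ^ 2 + η ^ 2) + √(b ^ 2 + η ^ 2)) 0 with h | h
  · have h1 := Real.sqrt_nonneg (a ^ 2 + η ^ 2)
    have h2 := Real.sqrt_nonneg (b ^ 2 + η ^ 2)
    have h3 : √(a ^ 2 + η ^ 2) = 0 := by linarith
    have h4 : √(b ^ 2 + η ^ 2) = 0 := by linarith
    rw [h3, h4, sub_self, abs_zero]
    exact abs_nonneg _
  · have hpos : 0 < √(a ^ 2 + η ^ 2) + √(b ^ 2 + η ^ 2) := lt_of_le_of_ne (by positivity) h.symm
    have ha : |a| ≤ √(a ^ 2 + η ^ 2) := Real.abs_le_sqrt (by nlinarith [sq_nonneg η])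
    have hb : |b| ≤ √(b ^ 2 + η ^ 2) := Real.abs_le_sqrt (by nlinarith [sq_nonneg η])
    have h1 : (√(a ^ 2 + η ^ 2) - √(b ^ 2 + η ^ 2)) * (√(a ^ 2 + η ^ 2) + √(b ^ 2 + η ^ 2)) =
        (a - b) * (a + b) := by
      have e1 := Real.sq_sqrt (by positivity : 0 ≤ a ^ 2 + η ^ 2)
      have e2 := Real.sq_sqrt (by positivity : 0 ≤ b ^ 2 + η ^ 2)
      linear_combination e1 - e2
    have h2 : |√(a ^ 2 + η ^ 2) - √(b ^ 2 + η ^ 2)| * (√(a ^ 2 + η ^ 2) + √(b ^ 2 + η ^ 2)) ≤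
        |a - b| * (√(a ^ 2 + η ^ 2) + √(b ^ 2 + η ^ 2)) := by
      rw [← abs_of_pos hpos, ← abs_mul, h1, abs_mul, abs_of_pos hpos]
      gcongr
      exact (abs_add_le a b).trans (add_le_add ha hb)
    exact le_of_mul_le_mul_right h2 hpos

/-- A smooth compactly supported approximation of the power mean of `|u|` and `|v|`: the absolute
values are replaced by `√(· ^ 2 + η ^ 2)`, and the subtraction of `η` restores the support. -/
noncomputable def smoothPowerMean {N : ℕ} (p t η : ℝ) (u v : EuclideanSpace ℝ (Fin N) → ℝ)
    (x : EuclideanSpace ℝ (Fin N)) : ℝ :=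
  powerMean p t √(u x ^ 2 + η ^ 2) √(v x ^ 2 + η ^ 2) - η

section SmoothPowerMean

variable {N : ℕ} {s p t η : ℝ} {U : Set (EuclideanSpace ℝ (Fin N))}
  {u v : EuclideanSpace ℝ (Fin N) → ℝ}

theorem IsTestFunction.smoothPowerMean (hp : 0 < p) (ht0 : 0 ≤ t) (ht1 : t ≤ 1) (hη : 0 < η)
    (hu : IsTestFunction U u) (hv : IsTestFunction U v) :
    IsTestFunction U (smoothPowerMean p t η u v) := by
  have hη2 : 0 < η ^ 2 := by positivity
  have hsq : ∀ f : EuclideanSpace ℝ (Fin N) → ℝ, ContDiff ℝ ∞ f →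
      ContDiff ℝ ∞ fun x => √(f x ^ 2 + η ^ 2) ^ p := fun f hf =>
    (((hf.pow 2).add contDiff_const).sqrt fun x => by positivity).rpow_const_of_ne
      fun x => by positivity
  refine hu.of_eq_zero hv ?_ fun x hux hvx => ?_
  · refine ContDiff.sub (ContDiff.rpow_const_of_ne ((contDiff_const.mul (hsq u hu.contDiff)).add
      (contDiff_const.mul (hsq v hv.contDiff))) fun x => ?_) contDiff_const
    have h1 : 0 < √(u x ^ 2 + η ^ 2) ^ p := by positivity
    have h2 : 0 < √(v x ^ 2 + η ^ 2) ^ p := by positivity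
    rcases ht0.eq_or_lt with h | h
    · simp only [← h, sub_zero, one_mul, zero_mul, add_zero]
      exact h1.ne'
    · have h3 : 0 ≤ 1 - t := by linarith
      positivity
  · simp only [_root_.smoothPowerMean, hux, hvx]
    rw [zero_pow two_ne_zero, zero_add, Real.sqrt_sq hη.le, powerMean_self hp hη.le, sub_self]

theorem smoothPowerMean_nonneg (hp : 0 < p) (ht0 : 0 ≤ t) (ht1 : t ≤ 1) (hη : 0 ≤ η)
    (x : EuclideanSpace ℝ (Fin N)) : 0 ≤ smoothPowerMean p t η u v x := by
  have h : ∀ a : ℝ, η ≤ √(a ^ 2 + η ^ 2) := fun a =>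
    Real.le_sqrt_of_sq_le (by nlinarith [sq_nonneg a])
  rw [smoothPowerMean, sub_nonneg]
  calc η = powerMean p t η η := (powerMean_self hp hη).symm
    _ ≤ _ := powerMean_mono hp ht0 ht1 hη hη (h _) (h _)

/-- The hidden convexity of the Gagliardo seminorm: `[·]_{s,p}^p` is convex along power means. -/
theorem toReal_gagliardo_smoothPowerMean_le (hN : 1 ≤ N) (hs0 : 0 < s) (hs1 : s < 1) (hp : 1 < p)
    (ht0 : 0 ≤ t) (ht1 : t ≤ 1) (hη : 0 < η) (hu : IsTestFunction U u)
    (hv : IsTestFunction U v) :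
    (gagliardo s p (smoothPowerMean p t η u v)).toReal ≤
      (1 - t) * (gagliardo s p u).toReal + t * (gagliardo s p v).toReal := by
  have hp0 : 0 < p := by linarith
  have hw := hu.smoothPowerMean hp0 ht0 ht1 hη hv
  have hI := fun {w} (hw : IsTestFunction U w) =>
    hw.integrable_abs_fracQuotient_rpow hN hs0 hs1 hp0
  have h1t : 0 ≤ 1 - t := by linarith
  rw [hu.toReal_gagliardo hp0, hv.toReal_gagliardo hp0, hw.toReal_gagliardo hp0,
    ← integral_const_mul, ← integral_const_mul,
    ← integral_add ((hI hu).const_mul _) ((hI hv).const_mul _)]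
  refine integral_mono (hI hw) (((hI hu).const_mul _).add ((hI hv).const_mul _)) fun z => ?_
  simp only [abs_fracQuotient_rpow hp0]
  rw [← mul_div_assoc, ← mul_div_assoc, ← add_div]
  gcongr
  rw [smoothPowerMean, smoothPowerMean, sub_sub_sub_cancel_right]
  refine (abs_powerMean_sub_rpow_le hp ht0 ht1 (Real.sqrt_nonneg _) (Real.sqrt_nonneg _)
    (Real.sqrt_nonneg _) (Real.sqrt_nonneg _)).trans ?_
  have hle : ∀ a b : ℝ, |√(a ^ 2 + η ^ 2) - √(b ^ 2 + η ^ 2)| ^ p ≤ |a - b| ^ p := fun a b =>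
    Real.rpow_le_rpow (abs_nonneg _) (abs_sqrt_sq_add_sub_le a b η) hp0.le
  exact add_le_add (mul_le_mul_of_nonneg_left (hle _ _) h1t)
    (mul_le_mul_of_nonneg_left (hle _ _) ht0)

end SmoothPowerMean

/-! ### Properties of the minimiser -/

namespace IsTorsionMinimizer

variable {N : ℕ} {s p : ℝ} {U : Set (EuclideanSpace ℝ (Fin N))}
  {u w : EuclideanSpace ℝ (Fin N) → ℝ}

theorem integrableOn (hp : 1 < p) (hU : volume U ≠ ⊤) (hw : IsTorsionMinimizer s p U w) :
    IntegrableOn w U := by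
  obtain ⟨⟨hm, φ, hφ, hL, -⟩, -⟩ := hw
  exact (tendsto_setIntegral_of_tendsto_eLpNorm hU hp hm hφ hL).1

/-- Minimality of `w` tested against the power means of `w` and a test function `u`. The
approximating test functions of `w` make the competitors smooth, and Fatou's lemma passes to the
limit. -/
theorem lintegral_powerMean_le (hN : 1 ≤ N) (hs0 : 0 < s) (hs1 : s < 1) (hp : 1 < p)
    (hw : IsTorsionMinimizer s p U w) (hu : IsTestFunction U u)
    {t : ℝ} (ht0 : 0 ≤ t) (ht1 : t ≤ 1) :
    ∫⁻ x in U, ENNReal.ofReal (powerMean p t |w x| |u x|) ≤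
      ENNReal.ofReal ((∫ x in U, w x) +
        t / p * ((gagliardo s p u).toReal - (gagliardo s p w).toReal)) := by
  have hp0 : 0 < p := by linarith
  obtain ⟨⟨hm, φ, hφ, hL, hG⟩, hmin⟩ := hw
  obtain ⟨ns, hns, hae⟩ := (tendstoInMeasure_of_tendsto_eLpNorm (by simpa using hp0)
    (fun n => (hφ n).aestronglyMeasurable) hm hL).exists_seq_tendsto_ae
  set η : ℕ → ℝ := fun n => 1 / ((n : ℝ) + 1) with hη
  have hη0 : ∀ n, 0 < η n := fun n => by positivity
  have hηlim : Tendsto η atTop (𝓝 0) := tendsto_one_div_add_atTop_nhds_zero_nat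
  set v : ℕ → EuclideanSpace ℝ (Fin N) → ℝ := fun n =>
    smoothPowerMean p t (η n) (φ (ns n)) u with hv
  have hvT : ∀ n, IsTestFunction U (v n) := fun n =>
    (hφ _).smoothPowerMean hp0 ht0 ht1 (hη0 n) hu
  have hvlim : ∀ᵐ x, Tendsto (fun n => v n x) atTop (𝓝 (powerMean p t |w x| |u x|)) := by
    filter_upwards [hae] with x hx
    have hsq : ∀ {f : ℕ → ℝ} {l : ℝ}, Tendsto f atTop (𝓝 l) →
        Tendsto (fun n => √(f n ^ 2 + η n ^ 2)) atTop (𝓝 |l|) := fun {f l} hf => by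
      have := ((hf.pow 2).add (hηlim.pow 2)).sqrt
      rwa [zero_pow two_ne_zero, add_zero, Real.sqrt_sq_eq_abs] at this
    have h1 := ((continuous_powerMean (t := t) hp0).tendsto (|w x|, |u x|)).comp
      ((hsq hx).prodMk_nhds (hsq (tendsto_const_nhds (x := u x))))
    have h2 := h1.sub hηlim
    rw [sub_zero] at h2
    exact h2
  have hvI : ∀ n, IntegrableOn (v n) U := fun n =>
    memLp_one_iff_integrable.1 (((hvT n).memLp 1).restrict U)
  have hbound : ∀ n, ∫⁻ x in U, ENNReal.ofReal (v n x) ≤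
      ENNReal.ofReal (1 / p * ((1 - t) * (gagliardo s p (φ (ns n))).toReal +
        t * (gagliardo s p u).toReal) - torsionEnergy s p U w) := by
    intro n
    rw [← ofReal_integral_eq_lintegral_ofReal (hvI n) (Eventually.of_forall fun x =>
      smoothPowerMean_nonneg hp0 ht0 ht1 (hη0 n).le x)]
    refine ENNReal.ofReal_le_ofReal ?_
    have h1 := hmin _ ((hvT n).memD0 (s := s) hp)
    have h2 := toReal_gagliardo_smoothPowerMean_le hN hs0 hs1 hp ht0 ht1 (hη0 n) (hφ (ns n)) hu
    have h3 : 1 / p * (gagliardo s p (v n)).toReal ≤ 1 / p *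
        ((1 - t) * (gagliardo s p (φ (ns n))).toReal + t * (gagliardo s p u).toReal) := by
      gcongr
    rw [torsionEnergy, torsionEnergy] at h1
    rw [torsionEnergy]
    linarith
  have hlim : Tendsto (fun n => ENNReal.ofReal (1 / p * ((1 - t) *
      (gagliardo s p (φ (ns n))).toReal + t * (gagliardo s p u).toReal) -
        torsionEnergy s p U w)) atTop (𝓝 (ENNReal.ofReal (1 / p * ((1 - t) *
      (gagliardo s p w).toReal + t * (gagliardo s p u).toReal) - torsionEnergy s p U w))) :=
    ENNReal.tendsto_ofReal ((((((tendsto_gagliardo hN hs0 hs1 hp hm hφ hG).comp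
      hns.tendsto_atTop).const_mul _).add_const _).const_mul _).sub_const _)
  calc ∫⁻ x in U, ENNReal.ofReal (powerMean p t |w x| |u x|)
      = ∫⁻ x in U, liminf (fun n => ENNReal.ofReal (v n x)) atTop := by
        refine lintegral_congr_ae (ae_restrict_of_ae ?_)
        filter_upwards [hvlim] with x hx
        exact (ENNReal.tendsto_ofReal hx).liminf_eq.symm
    _ ≤ liminf (fun n => ∫⁻ x in U, ENNReal.ofReal (v n x)) atTop :=
        lintegral_liminf_le fun n => (hvT n).continuous.measurable.ennreal_ofReal
    _ ≤ liminf (fun n => ENNReal.ofReal (1 / p * ((1 - t) *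
          (gagliardo s p (φ (ns n))).toReal + t * (gagliardo s p u).toReal) -
          torsionEnergy s p U w)) atTop := liminf_le_liminf (Eventually.of_forall hbound)
    _ = _ := by
        rw [hlim.liminf_eq, torsionEnergy]
        congr 1
        field_simp
        ring

/-- Comparing `w` with the smooth approximations of `|w|` (the power means with `t = 0`) gives
`∫ |w| ≤ ∫ w`. -/
theorem ae_nonneg (hN : 1 ≤ N) (hs0 : 0 < s) (hs1 : s < 1) (hp : 1 < p)
    (hU : volume U ≠ ⊤) (hw : IsTorsionMinimizer s p U w) :
    ∀ᵐ x ∂(volume.restrict U), 0 ≤ w x := by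
  have hp0 : 0 < p := by linarith
  have hint := hw.integrableOn hp hU
  have h := hw.lintegral_powerMean_le hN hs0 hs1 hp (IsTestFunction.zero U) le_rfl zero_le_one
  have hpm : ∀ x, powerMean p 0 |w x| |(0 : EuclideanSpace ℝ (Fin N) → ℝ) x| = |w x| := fun x => by
    simp [powerMean, Real.rpow_rpow_inv (abs_nonneg _) hp0.ne']
  simp only [hpm, zero_div, zero_mul, add_zero] at h
  rw [← ofReal_integral_eq_lintegral_ofReal hint.abs
    (Eventually.of_forall fun x => abs_nonneg _)] at h
  have hI0 : 0 ≤ ∫ x in U, |w x| := integral_nonneg fun x => abs_nonneg _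
  have hle : ∫ x in U, |w x| ≤ ∫ x in U, w x := by
    rcases le_or_gt 0 (∫ x in U, w x) with h0 | h0
    · exact (ENNReal.ofReal_le_ofReal_iff h0).1 h
    · rw [ENNReal.ofReal_of_nonpos h0.le, nonpos_iff_eq_zero, ENNReal.ofReal_eq_zero] at h
      have := abs_integral_le_integral_abs (f := w) (μ := volume.restrict U)
      linarith [neg_abs_le (∫ x in U, w x)]
  have hdiff : ∫ x in U, (|w x| - w x) = 0 := by
    refine le_antisymm ?_ (integral_nonneg fun x => sub_nonneg.2 (le_abs_self _))
    rw [integral_sub hint.abs hint]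
    linarith
  rw [integral_eq_zero_iff_of_nonneg (fun x => sub_nonneg.2 (le_abs_self _))
    (hint.abs.sub hint)] at hdiff
  filter_upwards [hdiff] with x hx
  have : |w x| - w x = 0 := hx
  linarith [abs_nonneg (w x)]

/-- The Euler–Lagrange equation tested against `w` itself. -/
theorem toReal_gagliardo_eq (hp : 1 < p) (hw : IsTorsionMinimizer s p U w) :
    (gagliardo s p w).toReal = ∫ x in U, w x := by
  have hp0 : 0 < p := by linarith
  set G := (gagliardo s p w).toReal with hG
  set I := ∫ x in U, w x with hI
  have hmin : IsLocalMin (fun c : ℝ => 1 / p * (c ^ p * G) - c * I) 1 := by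
    filter_upwards [eventually_gt_nhds (zero_lt_one' ℝ)] with c hc
    have h := hw.2 _ (hw.1.const_smul c)
    simp only [torsionEnergy, gagliardo_smul, ENNReal.toReal_mul, Pi.smul_apply, smul_eq_mul,
      integral_const_mul] at h
    rw [ENNReal.toReal_ofReal (by positivity), abs_of_pos hc] at h
    simpa using h
  have hder : HasDerivAt (fun c : ℝ => 1 / p * (c ^ p * G) - c * I)
      (1 / p * (p * (1 : ℝ) ^ (p - 1) * G) - 1 * I) 1 :=
    (((Real.hasDerivAt_rpow_const (Or.inl one_ne_zero)).mul_const G).const_mul (1 / p)).sub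
      ((hasDerivAt_id 1).mul_const I)
  have h0 := hmin.hasDerivAt_eq_zero hder
  rw [Real.one_rpow] at h0
  field_simp at h0
  linarith

end IsTorsionMinimizer

/-! ### The weighted inequality on bounded sets -/

theorem hasDerivAt_one_sub_rpow (q : ℝ) :
    HasDerivAt (fun t : ℝ => (1 - t) ^ q) (-q) 0 := by
  have h := ((hasDerivAt_id (0 : ℝ)).const_sub 1).rpow_const (p := q) (Or.inl (by simp))
  simpa using h

theorem tendsto_powerMean_slope {p a b : ℝ} (hp : 1 < p) (ha : 0 < a) :
    Tendsto (fun t => p / t * (powerMean p t a b - (1 - t) ^ p⁻¹ * a)) (𝓝[>] 0)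
      (𝓝 (b ^ p / a ^ (p - 1))) := by
  have hp0 : 0 < p := by linarith
  have hbase : HasDerivAt (fun t : ℝ => (1 - t) * a ^ p + t * b ^ p)
      (-1 * a ^ p + 1 * b ^ p) 0 :=
    (((hasDerivAt_id (0 : ℝ)).const_sub 1).mul_const _).add ((hasDerivAt_id (0 : ℝ)).mul_const _)
  have hder := (hbase.rpow_const (p := p⁻¹) (Or.inl (by simp; positivity))).sub
    ((hasDerivAt_one_sub_rpow p⁻¹).mul_const a)
  have hlim := (hder.tendsto_slope_zero_right).const_mul p
  have hval : p * ((-1 * a ^ p + 1 * b ^ p) * p⁻¹ *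
      ((1 - 0) * a ^ p + 0 * b ^ p) ^ (p⁻¹ - 1) - -p⁻¹ * a) = b ^ p / a ^ (p - 1) := by
    have h1 : ((1 - 0) * a ^ p + 0 * b ^ p) ^ (p⁻¹ - 1) = (a ^ (p - 1))⁻¹ := by
      rw [sub_zero, one_mul, zero_mul, add_zero, ← Real.rpow_mul ha.le, ← Real.rpow_neg ha.le]
      congr 1
      field_simp
      ring
    have h2 : a ^ p = a ^ (p - 1) * a := by
      rw [← Real.rpow_add_one ha.ne']; congr 1; ring
    have h3 : 0 < a ^ (p - 1) := by positivity
    rw [h1, h2]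
    field_simp
    ring
  rw [hval] at hlim
  refine hlim.congr fun t => ?_
  have h0 : (a ^ p) ^ p⁻¹ = a := Real.rpow_rpow_inv ha.le hp0.ne'
  simp [powerMean, h0]
  ring

/-- At points where `a = 0` the difference quotient blows up, so that the extended value `b ^ p / 0`
of the weight is also attained in the limit. -/
theorem ofReal_div_le_liminf_powerMean_slope {p a b : ℝ} (hp : 1 < p) (ha : 0 ≤ a) (hb : 0 ≤ b) :
    ENNReal.ofReal (b ^ p) / ENNReal.ofReal a ^ (p - 1) ≤
      liminf (fun t => ENNReal.ofReal (p / t * (powerMean p t a b - (1 - t) ^ p⁻¹ * a)))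
        (𝓝[>] 0) := by
  have hp0 : 0 < p := by linarith
  have hp1 : 0 < p - 1 := by linarith
  rcases ha.eq_or_lt with rfl | ha
  · rcases hb.eq_or_lt with rfl | hb
    · simp [Real.zero_rpow hp0.ne']
    · have hpm : ∀ t : ℝ, 0 < t → p / t * (powerMean p t 0 b - (1 - t) ^ p⁻¹ * 0) =
          p * b * t ^ (p⁻¹ - 1) := by
        intro t ht
        rw [powerMean, Real.zero_rpow hp0.ne', mul_zero, zero_add, mul_zero, sub_zero,
          Real.mul_rpow ht.le (by positivity), Real.rpow_rpow_inv hb.le hp0.ne',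
          Real.rpow_sub_one ht.ne']
        ring
      have hexp : p⁻¹ - 1 < 0 := by
        have := inv_lt_one_of_one_lt₀ hp
        linarith
      have hlim : Tendsto (fun t : ℝ => p * b * t ^ (p⁻¹ - 1)) (𝓝[>] 0) atTop :=
        (tendsto_rpow_neg_nhdsGT_zero hexp).const_mul_atTop (by positivity)
      have hlim2 : Tendsto (fun t =>
          ENNReal.ofReal (p / t * (powerMean p t 0 b - (1 - t) ^ p⁻¹ * 0))) (𝓝[>] 0) (𝓝 ⊤) := by
        refine (ENNReal.tendsto_ofReal_atTop.comp hlim).congr' ?_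
        filter_upwards [self_mem_nhdsWithin] with t ht
        rw [hpm t ht, Function.comp_apply]
      rw [hlim2.liminf_eq]
      exact le_top
  · rw [(ENNReal.tendsto_ofReal (tendsto_powerMean_slope (b := b) hp ha)).liminf_eq,
      ENNReal.ofReal_rpow_of_pos ha, ENNReal.ofReal_div_of_pos (by positivity)]

/-- The Hardy-type inequality on a bounded set: divide the comparison of `w` with the power means
of `w` and `|u|` by `t`, and let `t → 0` with Fatou's lemma. -/
theorem IsTorsionMinimizer.lintegral_div_rpow_le {N : ℕ} (hN : 1 ≤ N) {s p : ℝ} (hs0 : 0 < s)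
    (hs1 : s < 1) (hp : 1 < p) {U : Set (EuclideanSpace ℝ (Fin N))} (hU : volume U ≠ ⊤)
    {u w : EuclideanSpace ℝ (Fin N) → ℝ} (hw : IsTorsionMinimizer s p U w)
    (hu : IsTestFunction U u) :
    ∫⁻ x in U, ENNReal.ofReal (|u x| ^ p) / ENNReal.ofReal (w x) ^ (p - 1) ≤
      gagliardo s p u := by
  have hp0 : 0 < p := by linarith
  have hnn := hw.ae_nonneg hN hs0 hs1 hp hU
  have hint := hw.integrableOn hp hU
  set I := ∫ x in U, w x with hI
  have hGw : (gagliardo s p w).toReal = I := hw.toReal_gagliardo_eq hp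
  have hI0 : 0 ≤ I := integral_nonneg_of_ae hnn
  set G := (gagliardo s p u).toReal with hG
  have hG0 : 0 ≤ G := ENNReal.toReal_nonneg
  set F : ℝ → EuclideanSpace ℝ (Fin N) → ℝ := fun t x =>
    powerMean p t (w x) |u x| - (1 - t) ^ p⁻¹ * w x with hF
  have hwm : AEMeasurable w (volume.restrict U) := hint.aemeasurable
  have hFm : ∀ t, AEMeasurable (F t) (volume.restrict U) := fun t =>
    ((continuous_powerMean hp0).measurable.comp_aemeasurable
      (hwm.prodMk hu.continuous.abs.measurable.aemeasurable)).sub (hwm.const_mul _)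
  have hbound : ∀ t : ℝ, 0 < t → t < 1 →
      ∫⁻ x in U, ENNReal.ofReal (p / t * F t x) ≤
        ENNReal.ofReal (G + I * (p / t * (1 - (1 - t) ^ p⁻¹) - 1)) := by
    intro t ht0 ht1
    have h1t : 0 < 1 - t := by linarith
    have hF0 : ∀ x, 0 ≤ w x → 0 ≤ F t x := by
      intro x hx
      rw [hF, sub_nonneg, ← Real.rpow_rpow_inv hx hp0.ne',
        ← Real.mul_rpow h1t.le (by positivity), powerMean,
        Real.rpow_rpow_inv hx hp0.ne']
      refine Real.rpow_le_rpow (by positivity) ?_ (by positivity)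
      have : 0 ≤ t * |u x| ^ p := by positivity
      linarith
    -- splitting off `(1 - t) ^ (1 / p) * w` keeps all integrands nonnegative
    have hmain : (∫⁻ x in U, ENNReal.ofReal (F t x)) + ENNReal.ofReal ((1 - t) ^ p⁻¹ * I) ≤
        ENNReal.ofReal (I + t / p * (G - I)) := by
      have h := hw.lintegral_powerMean_le hN hs0 hs1 hp hu ht0.le ht1.le
      rw [hGw] at h
      refine le_trans (le_of_eq ?_) h
      rw [hI, ← integral_const_mul, ofReal_integral_eq_lintegral_ofReal (hint.const_mul _)
        (by filter_upwards [hnn] with x hx; exact mul_nonneg (by positivity) hx),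
        ← lintegral_add_left' (hFm t).ennreal_ofReal]
      refine lintegral_congr_ae ?_
      filter_upwards [hnn] with x hx
      rw [← ENNReal.ofReal_add (hF0 x hx) (by positivity), abs_of_nonneg hx]
      simp only [hF, sub_add_cancel]
    have hsub : ∫⁻ x in U, ENNReal.ofReal (F t x) ≤
        ENNReal.ofReal (I + t / p * (G - I) - (1 - t) ^ p⁻¹ * I) := by
      rw [ENNReal.ofReal_sub _ (by positivity)]
      exact ENNReal.le_sub_of_add_le_right ENNReal.ofReal_ne_top hmain
    have hpt : 0 ≤ p / t := by positivity
    calc ∫⁻ x in U, ENNReal.ofReal (p / t * F t x)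
        = ENNReal.ofReal (p / t) * ∫⁻ x in U, ENNReal.ofReal (F t x) := by
          rw [← lintegral_const_mul' _ _ ENNReal.ofReal_ne_top]
          simp only [ENNReal.ofReal_mul hpt]
      _ ≤ ENNReal.ofReal (p / t) * ENNReal.ofReal (I + t / p * (G - I) - (1 - t) ^ p⁻¹ * I) := by
          gcongr
      _ = _ := by
          rw [← ENNReal.ofReal_mul hpt]
          congr 1
          field_simp
          ring
  have hlim : Tendsto (fun t : ℝ => ENNReal.ofReal (G + I * (p / t * (1 - (1 - t) ^ p⁻¹) - 1)))
      (𝓝[>] 0) (𝓝 (ENNReal.ofReal G)) := by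
    have h1 : Tendsto (fun t : ℝ => p / t * (1 - (1 - t) ^ p⁻¹)) (𝓝[>] 0) (𝓝 1) := by
      have h := ((hasDerivAt_one_sub_rpow p⁻¹).tendsto_slope_zero_right).const_mul (-p)
      rw [neg_mul_neg, mul_inv_cancel₀ hp0.ne'] at h
      refine h.congr fun t => ?_
      simp
      ring
    have h2 := ((h1.sub_const 1).const_mul I).const_add G
    rw [sub_self, mul_zero, add_zero] at h2
    exact ENNReal.tendsto_ofReal h2
  calc ∫⁻ x in U, ENNReal.ofReal (|u x| ^ p) / ENNReal.ofReal (w x) ^ (p - 1)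
      ≤ ∫⁻ x in U, liminf (fun t => ENNReal.ofReal (p / t * F t x)) (𝓝[>] 0) := by
        refine lintegral_mono_ae ?_
        filter_upwards [hnn] with x hx
        exact ofReal_div_le_liminf_powerMean_slope hp hx (abs_nonneg _)
    _ ≤ liminf (fun t => ∫⁻ x in U, ENNReal.ofReal (p / t * F t x)) (𝓝[>] 0) :=
        lintegral_liminf_le' fun t => ((hFm t).const_mul _).ennreal_ofReal
    _ ≤ liminf (fun t : ℝ => ENNReal.ofReal (G + I * (p / t * (1 - (1 - t) ^ p⁻¹) - 1)))
          (𝓝[>] 0) := by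
        refine liminf_le_liminf ?_
        filter_upwards [Ioo_mem_nhdsGT (zero_lt_one' ℝ)] with t ht
        exact hbound t ht.1 ht.2
    _ = gagliardo s p u := by
        rw [hlim.liminf_eq, hG, ENNReal.ofReal_toReal (hu.gagliardo_ne_top hN hs0 hs1 hp0)]

/-! ### Exhaustion by bounded sets -/

theorem ENNReal.div_limsup_rpow {ι : Type*} {l : Filter ι} [l.NeBot] {c : ℝ≥0∞}
    (hc : c ≠ ⊤) {r : ℝ} (hr : 0 ≤ r) (f : ι → ℝ≥0∞) :
    c / limsup f l ^ r = liminf (fun i => c / f i ^ r) l := by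
  have hanti : Antitone fun y : ℝ≥0∞ => c / y ^ r := fun y z hyz =>
    ENNReal.div_le_div_left (ENNReal.rpow_le_rpow hyz hr) c
  have hcont : Continuous fun y : ℝ≥0∞ => c / y ^ r := by
    simp only [div_eq_mul_inv]
    exact (ENNReal.continuous_const_mul hc).comp
      (continuous_inv.comp ENNReal.continuous_rpow_const)
  exact hanti.map_limsup_of_continuousAt f hcont.continuousAt

theorem exists_isTorsionMinimizer_torsionBounded_eq {N : ℕ} (hN : 1 ≤ N) {s p : ℝ} (hs0 : 0 < s)
    (hs1 : s < 1) (hp : 1 < p) {U : Set (EuclideanSpace ℝ (Fin N))} {R : ℝ} (hR : 0 < R)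
    (hU : U ⊆ Metric.ball 0 R) :
    ∃ w, IsTorsionMinimizer s p U w ∧ torsionBounded s p U = U.indicator w := by
  have h := exists_isTorsionMinimizer hN hs0 hs1 hp hR hU
  exact ⟨h.choose, h.choose_spec, by rw [torsionBounded, dif_pos h]⟩

theorem corollary4p2 (N : ℕ) (hN : 1 ≤ N) (s p : ℝ) (hs0 : 0 < s) (hs1 : s < 1) (hp : 1 < p)
    (Ω : Set (EuclideanSpace ℝ (Fin N))) (hΩ : IsOpen Ω)
    (u : EuclideanSpace ℝ (Fin N) → ℝ) (hu : IsTestFunction Ω u) :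
    ∫⁻ x in Ω, ENNReal.ofReal (|u x| ^ p) / torsionFunction s p Ω x ^ (p - 1) ≤
      gagliardo s p u := by
  have hp0 : 0 < p := by linarith
  obtain ⟨R, hR⟩ := hu.hasCompactSupport.isCompact.isBounded.subset_ball
    (0 : EuclideanSpace ℝ (Fin N))
  set U : ℕ → Set (EuclideanSpace ℝ (Fin N)) := fun n => Ω ∩ Metric.ball 0 (n : ℝ) with hUdef
  have hUm : ∀ n, MeasurableSet (U n) := fun n => (hΩ.inter Metric.isOpen_ball).measurableSet
  set f : ℕ → EuclideanSpace ℝ (Fin N) → ℝ≥0∞ := fun n x =>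
    ENNReal.ofReal (|u x| ^ p) / ENNReal.ofReal (torsionBounded s p (U n) x) ^ (p - 1) with hf
  have hzero : ∀ {x}, u x = 0 → ENNReal.ofReal (|u x| ^ p) = 0 := fun hx => by
    simp [hx, Real.zero_rpow hp0.ne']
  have hlarge : ∀ᶠ n : ℕ in atTop, 0 < (n : ℝ) ∧ R ≤ n :=
    (tendsto_natCast_atTop_atTop.eventually_gt_atTop (0 : ℝ)).and
      (tendsto_natCast_atTop_atTop.eventually_ge_atTop R)
  obtain ⟨n₀, hn₀⟩ := eventually_atTop.1 hlarge
  have hkey : ∀ n, n₀ ≤ n → AEMeasurable (f n) (volume.restrict Ω) ∧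
      ∫⁻ x in Ω, f n x ≤ gagliardo s p u := by
    intro n hn
    obtain ⟨hnpos, hRn⟩ := hn₀ n hn
    have huU : IsTestFunction (U n) u := ⟨hu.contDiff, hu.hasCompactSupport,
      Set.subset_inter hu.tsupport_subset (hR.trans (Metric.ball_subset_ball hRn))⟩
    have hUsub : U n ⊆ Metric.ball 0 (n : ℝ) := Set.inter_subset_right
    have hUfin : volume (U n) ≠ ⊤ :=
      ne_top_of_le_ne_top measure_ball_lt_top.ne (measure_mono hUsub)
    obtain ⟨w, hw, hwU⟩ :=
      exists_isTorsionMinimizer_torsionBounded_eq hN hs0 hs1 hp hnpos hUsub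
    have hwm : AEMeasurable w volume := hw.1.1.aemeasurable
    refine ⟨?_, ?_⟩
    · have h1 : AEMeasurable (fun x => ENNReal.ofReal (torsionBounded s p (U n) x)) volume := by
        rw [hwU]; exact (hwm.indicator (hUm n)).ennreal_ofReal
      have h2 : Measurable fun x => ENNReal.ofReal (|u x| ^ p) :=
        (hu.continuous.abs.measurable.pow_const p).ennreal_ofReal
      exact (h2.aemeasurable.div (h1.pow_const _)).restrict
    · have hind : f n = (U n).indicator (f n) := by
        refine (Set.indicator_eq_self.2 fun x hx => ?_).symm
        by_contra hxU
        exact hx (by simp only [hf, hzero (huU.eq_zero hxU), ENNReal.zero_div])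
      calc ∫⁻ x in Ω, f n x ≤ ∫⁻ x, f n x := setLIntegral_le_lintegral _ _
        _ = ∫⁻ x in U n, f n x := by
            rw [← lintegral_indicator (hUm n), ← hind]
        _ = ∫⁻ x in U n, ENNReal.ofReal (|u x| ^ p) / ENNReal.ofReal (w x) ^ (p - 1) := by
            refine setLIntegral_congr_fun (hUm n) fun x hx => ?_
            simp only [hf, hwU, Set.indicator_of_mem hx]
        _ ≤ gagliardo s p u := hw.lintegral_div_rpow_le hN hs0 hs1 hp hUfin huU
  calc ∫⁻ x in Ω, ENNReal.ofReal (|u x| ^ p) / torsionFunction s p Ω x ^ (p - 1)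
      = ∫⁻ x in Ω, liminf (fun n => f (n + n₀) x) atTop := by
        refine lintegral_congr fun x => ?_
        rw [liminf_nat_add (fun n => f n x) n₀]
        rw [torsionFunction, ENNReal.div_limsup_rpow ENNReal.ofReal_ne_top (by linarith)]
    _ ≤ liminf (fun n => ∫⁻ x in Ω, f (n + n₀) x) atTop :=
        lintegral_liminf_le' fun n => (hkey _ (Nat.le_add_left _ _)).1
    _ ≤ liminf (fun _ : ℕ => gagliardo s p u) atTop :=
        liminf_le_liminf (Eventually.of_forall fun n => (hkey _ (Nat.le_add_left _ _)).2)
    _ = gagliardo s p u := liminf_const _
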